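/- All graphs are finite, simple and undirected. For $\ell\in\mathbb N=\{1,2,\dots\}$, a valid $\ell$-colouring of a graph $G=(V,E)$ is a map $c:V\to\{1,\dots,\ell\}$ with $c(u)\ne c(v)$ for every edge $\{u,v\}\in E$. A marking sequence of $(G,c)$ is an enumeration $e=(x_1,\dots,x_r)$, without repetition, of the set $\{c(v)\mid v\in V\}$ of the colours that occur. For $1\le i\le r$ let $G_i$ be the subgraph of $G$ induced by $\{v\in V\mid c(v)\in\{x_1,\dots,x_i\}\}$. Let $\mathrm{loc}(G,c,e)$ be the maximum over $1\le i\le r$ of the number of connected components of $G_i$, and define the locality of $(G,c)$ by $\mathrm{loc}(G,c)=\min_e\mathrm{loc}(G,c,e)$, where $e$ ranges over all marking sequences. (So for a nonempty graph, $\mathrm{loc}(G,c)=1$ means that for some marking sequence all of the subgraphs $G_1,\dots,G_r$ are connected.) Let $\mathsf{Loc}_{G,1}$ be the problem of deciding, for a connected (in particular nonempty) graph $G$ with a valid $\ell$-colouring $c$, whether $\mathrm{loc}(G,c)=1$. An instance with vertices $0,\dots,n-1$ is encoded as a word over $\{0,1,\#\}$ by listing, for each vertex in turn, its colour in binary (least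 significant bit first) and its row of the adjacency matrix, each followed by $\#$. **Theorem.** $\mathsf{Loc}_{G,1}\in\mathsf P$. That is, there are a deterministic Turing machine and a polynomial $p$ such that on every word $w$ over $\{0,1,\#\}$ the machine halts after at most $p(|w|)$ steps and decides correctly whether $w$ is the encoding of a connected graph $G$ together with a colouring $c$ that is a valid $\ell$-colouring for some $\ell\in\mathbb N$ and satisfies $\mathrm{loc}(G,c)=1$. -/

import Mathlib

namespace GraphLocality

section Locality

variable {V : Type*}

/-- `c` is a valid `ℓ`-colouring of `G`: the colours are taken from `[ℓ] = {1, …, ℓ}` and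
adjacent vertices get different colours. -/
def IsValidColouring (G : SimpleGraph V) (ℓ : ℕ) (c : V → ℕ) : Prop :=
  (∀ v, 1 ≤ c v ∧ c v ≤ ℓ) ∧ ∀ u v, G.Adj u v → c u ≠ c v

/-- `e` is a marking sequence: an enumeration, without repetition, of the set of the colours
that occur under `c`. -/
def IsMarkingSequence (c : V → ℕ) (e : List ℕ) : Prop :=
  e.Nodup ∧ ∀ x, x ∈ e ↔ x ∈ Set.range c

/-- The subgraph `G|_C` of `G` induced by the vertices whose colour lies in `C`. -/
def inducedByColours (G : SimpleGraph V) (c : V → ℕ) (C : Set ℕ) :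
    SimpleGraph {v : V | c v ∈ C} :=
  G.induce {v : V | c v ∈ C}

/-- The number of connected components of a graph. -/
noncomputable def numComponents {W : Type*} (H : SimpleGraph W) : ℕ :=
  Nat.card H.ConnectedComponent

/-- The locality of `G` with respect to the marking sequence `e`: the maximum, over
`i = 1, …, |e|`, of the number of connected components of the subgraph induced by the
first `i` colours of `e`. -/
noncomputable def locSeq (G : SimpleGraph V) (c : V → ℕ) (e : List ℕ) : ℕ :=
  (Finset.Icc 1 e.length).sup fun i => numComponents (inducedByColours G c {x | x ∈ e.take i})

/-- Marking sequences exist, so that the minimum in `loc` is over a nonempty set. -/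
theorem exists_isMarkingSequence [Finite V] (c : V → ℕ) : ∃ e, IsMarkingSequence c e :=
  ⟨(Set.finite_range c).toFinset.toList, Finset.nodup_toList _, fun x => by simp⟩

/-- The locality of the coloured graph `(G, c)`: the minimum of `locSeq G c e` over all marking
sequences `e`. -/
noncomputable def loc (G : SimpleGraph V) (c : V → ℕ) : ℕ :=
  sInf {k | ∃ e, IsMarkingSequence c e ∧ locSeq G c e = k}

end Locality

section Encoding

/-- A finite graph on the vertices `0, …, n - 1` with a colour (a natural number) at each vertex. -/
structure ColouredGraph where
  /-- the number of vertices -/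
  n : ℕ
  /-- the graph -/
  graph : SimpleGraph (Fin n)
  /-- the colouring -/
  colour : Fin n → ℕ

/-- A block of bits, closed by the separator `none`. -/
def block (l : List Bool) : List (Option Bool) :=
  l.map some ++ [none]

open Classical in
/-- The row of the adjacency matrix that belongs to the vertex `v`. -/
noncomputable def ColouredGraph.row (x : ColouredGraph) (v : Fin x.n) : List Bool :=
  List.ofFn fun u => decide (x.graph.Adj v u)

/-- The encoding of a coloured graph as a word over the alphabet `{0, 1, #}`, which is
`Option Bool` with `none` as the separator `#`: for each vertex its colour in binary
(least significant bit first) and its row of the adjacency matrix, both closed by `#`. -/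
noncomputable def ColouredGraph.encode (x : ColouredGraph) : List (Option Bool) :=
  (List.ofFn fun v => block (x.colour v).bits ++ block (x.row v)).flatten

/-- Blocks can be read off unambiguously. -/
theorem block_append_inj {a b : List Bool} {x y : List (Option Bool)}
    (h : block a ++ x = block b ++ y) : a = b ∧ x = y := by
  induction a generalizing b with
  | nil => cases b <;> simp_all [block]
  | cons p a ih =>
    cases b with
    | nil => simp [block] at h
    | cons q b =>
      simp only [block, List.map_cons, List.cons_append, List.cons.injEq, Option.some.injEq] at h
      have := ih (b := b) (by simpa [block] using h.2)
      simp [h.1, this]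

/-- Sequences of pairs of blocks can be read off unambiguously. -/
theorem flatten_blocks_inj : ∀ {r s : List (List Bool × List Bool)},
    (r.map fun p => block p.1 ++ block p.2).flatten =
      (s.map fun p => block p.1 ++ block p.2).flatten → r = s
  | [], [], _ => rfl
  | [], q :: s, h => by simp [block] at h
  | p :: r, [], h => by simp [block] at h
  | p :: r, q :: s, h => by
    simp only [List.map_cons, List.flatten_cons, List.append_assoc] at h
    obtain ⟨h1, h2⟩ := block_append_inj h
    obtain ⟨h3, h4⟩ := block_append_inj h2
    rw [flatten_blocks_inj h4, Prod.ext h1 h3]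

/-- A number is determined by its binary representation. -/
theorem foldr_bit_bits (k : ℕ) : List.foldr Nat.bit 0 k.bits = k := by
  induction k using Nat.binaryRec' with
  | zero => simp
  | bit b n hn ih => rw [Nat.bits_append_bit _ _ hn]; simp [ih]

/-- Different coloured graphs have different encodings. -/
theorem ColouredGraph.encode_injective : Function.Injective ColouredGraph.encode := by
  intro x y h
  have key : ∀ x : ColouredGraph, x.encode =
      ((List.ofFn fun v => ((x.colour v).bits, x.row v)).map
        fun p => block p.1 ++ block p.2).flatten := by
    intro x
    simp [ColouredGraph.encode, List.map_ofFn, Function.comp_def]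
  rw [key, key] at h
  have h := flatten_blocks_inj h
  have hn : x.n = y.n := by simpa using congrArg List.length h
  obtain ⟨n, G, c⟩ := x
  obtain ⟨m, H, d⟩ := y
  obtain rfl : n = m := hn
  have h := List.ofFn_injective h
  have hc : c = d := by
    funext v
    have hv : (c v).bits = (d v).bits := congrArg Prod.fst (congrFun h v)
    rw [← foldr_bit_bits (c v), ← foldr_bit_bits (d v), hv]
  have hG : G = H := by
    ext u v
    have hu := congrArg Prod.snd (congrFun h u)
    have huv := congrFun (List.ofFn_injective hu) v
    simpa using huv
  rw [hc, hG]

end Encoding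

section Complexity

open Classical in
/-- The class `P`: a language over a finite alphabet is in `P` if its characteristic function is
computed by a Turing machine (with finitely many stacks over finite alphabets) whose number of
steps on every word is bounded by a polynomial in the length of the word. -/
def InP {Γ : Type} [Finite Γ] (L : Language Γ) : Prop :=
  ∃ M : Turing.TM2ComputableInPolyTime (id : List Γ → List Γ) Computability.encodeBool
      (fun w => decide (w ∈ L)),
    ∀ k, Finite (M.tm.Γ k)

end Complexity

/-- The decision problem `Loc_{G,1}`, as the language of the encodings of its yes-instances:
connected graphs with a valid `ℓ`-colouring, for some `ℓ`, whose locality is `1`. -/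
def LocG1 : Language (Option Bool) :=
  {w | ∃ x : ColouredGraph, x.encode = w ∧ x.graph.Connected ∧
    (∃ ℓ : ℕ, IsValidColouring x.graph ℓ x.colour) ∧ loc x.graph x.colour = 1}

end GraphLocality

/-! ### Stack programs with a cost semantics, and their compilation to machines -/

namespace GraphLocality

open Turing StateTransition

/-! Colours can be marked greedily. In a properly coloured graph no edge lies inside a colour class.
So if all prefixes of a marking sequence induce connected graphs, the first class is a single vertex
`s`, and every vertex of a later class has a neighbour of an earlier colour. Conversely, these two
conditions make all prefixes connected. The second one only becomes easier when more colours are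
marked, so after the choice of `s` nothing is left to choose: from each `s` with a colour of its
own, repeatedly mark all classes whose vertices all have marked neighbours, and accept if some start
marks everything. As many rounds as there are vertices suffice. A complete marking also proves that
the graph is connected, so connectedness needs no separate test. This is `connected_and_loc_iff`,
which rests on `exists_good` and `exists_markedSet_of_loc`.

The rest shows that this procedure runs on a Turing machine in polynomial time. Programs on stacks
of bits have a cost semantics `Exec`, and `Prog.Exec.steps` compiles them within the same time
bound. Data are binary trees, stored as prefix codes. The relation `Comp` and its typed form `PT`
are closed under composition, pairing, case distinction, and iteration with polynomially bounded
intermediate values. The decision procedure is a functional program built from such operations, so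
`pt_decideLoc` follows its syntax. `inP_of_pt` adds input and output, and `mem_locG1_iff` shows that
exactly the encodings of yes-instances are accepted. -/

/-- Programs acting on stacks of bits that are indexed by natural numbers. -/
inductive Prog
  | skip : Prog
  | push (r : ℕ) (a : Bool) : Prog
  | pop (r : ℕ) (k : Option Bool → Prog) : Prog
  | seq (p q : Prog) : Prog
  | loop (r : ℕ) (k : Bool → Prog) : Prog

namespace Prog

/-- A strict upper bound for the stacks that occur in a program. -/
def bound : Prog → ℕ
  | skip => 0
  | push r _ => r + 1
  | pop r k => max (r + 1) (max (k none).bound (max (k (some false)).bound (k (some true)).bound))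
  | seq p q => max p.bound q.bound
  | loop r k => max (r + 1) (max (k false).bound (k true).bound)

theorem bound_pop_le (r : ℕ) (k : Option Bool → Prog) (o : Option Bool) :
    (k o).bound ≤ (pop r k).bound := by
  rcases o with _ | _ | _ <;> simp [bound]

theorem bound_loop_le (r : ℕ) (k : Bool → Prog) (o : Bool) :
    (k o).bound ≤ (loop r k).bound := by
  rcases o with _ | _ <;> simp [bound]

/-- `Exec p S S' t`: started with the stacks `S`, the program `p` halts after at most `t` steps
with the stacks `S'`. -/
inductive Exec : Prog → (ℕ → List Bool) → (ℕ → List Bool) → ℕ → Prop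
  | skip (S) : Exec skip S S 1
  | push (r a S) : Exec (push r a) S (Function.update S r (a :: S r)) 1
  | pop {r k S S' t} : Exec (k (S r).head?) (Function.update S r (S r).tail) S' t →
      Exec (pop r k) S S' (t + 1)
  | seq {p q S S' S'' t t'} : Exec p S S' t → Exec q S' S'' t' → Exec (seq p q) S S'' (t + t')
  | loop_nil {r k S} : S r = [] → Exec (loop r k) S S 1
  | loop_cons {r k S S' S'' a l t t'} : S r = a :: l → Exec (k a) (Function.update S r l) S' t →
      Exec (loop r k) S' S'' t' → Exec (loop r k) S S'' (t + t' + 1)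
  | mono {p S S' t t'} : Exec p S S' t → t ≤ t' → Exec p S S' t'

/-- One unit of time pushes at most one symbol. This turns time bounds into bounds on the size of
results, which composition needs. -/
theorem Exec.length_le {p S S' t} (h : Exec p S S' t) (r : ℕ) :
    (S' r).length ≤ (S r).length + t := by
  induction h with
  | skip => simp
  | push r' a S =>
    by_cases h : r = r'
    · subst h; simp
    · simp [h]
  | @pop r' k S S' t _ ih =>
    by_cases h : r = r'
    · subst h; simp at *; omega
    · simp [h] at *; omega
  | seq _ _ ih₁ ih₂ => omega
  | loop_nil => omega
  | @loop_cons r' k S S' S'' a l t t' e _ _ ih₁ ih₂ =>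
    by_cases h : r = r'
    · subst h; simp [e] at *; omega
    · simp [h] at *; omega
  | mono _ _ ih => omega

/-- The labels of the compiled program. -/
def Lab : Prog → Type
  | skip => Unit
  | push _ _ => Unit
  | pop _ k => Option (Σ o, Lab (k o))
  | seq p q => Lab p ⊕ Lab q
  | loop _ k => Option (Σ o, Lab (k o))

theorem finite_lab : ∀ p : Prog, Finite p.Lab
  | skip => inferInstanceAs (Finite Unit)
  | push _ _ => inferInstanceAs (Finite Unit)
  | pop _ k => by
    have := fun o => finite_lab (k o)
    exact inferInstanceAs (Finite (Option (Σ o, Lab (k o))))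
  | seq p q => by
    have := finite_lab p
    have := finite_lab q
    exact inferInstanceAs (Finite (Lab p ⊕ Lab q))
  | loop _ k => by
    have := fun o => finite_lab (k o)
    exact inferInstanceAs (Finite (Option (Σ o, Lab (k o))))

/-- The label at which the compiled program starts. -/
def entry : (p : Prog) → p.Lab
  | skip => ()
  | push _ _ => ()
  | pop _ _ => none
  | seq p _ => Sum.inl p.entry
  | loop _ _ => none

end Prog

/-- The stack alphabets of the compiled machine: one input stack and `N + 1` stacks of bits. -/
abbrev StackSym (N : ℕ) : Option (Fin (N + 1)) → Type
  | none => Option Bool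
  | some _ => Bool

instance (N : ℕ) (k : Option (Fin (N + 1))) : Fintype (StackSym N k) :=
  match k with
  | none => inferInstanceAs (Fintype (Option Bool))
  | some _ => inferInstanceAs (Fintype Bool)

/-- The stacks of the compiled machine. -/
def machineStacks (N : ℕ) (inp : List (Option Bool)) (S : ℕ → List Bool) :
    (k : Option (Fin (N + 1))) → List (StackSym N k)
  | none => inp
  | some i => S i

theorem update_machineStacks {N r : ℕ} (hr : r < N + 1) (inp : List (Option Bool))
    (S : ℕ → List Bool) (l : List Bool) :
    Function.update (machineStacks N inp S) (some (Fin.ofNat (N + 1) r)) l =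
      machineStacks N inp (Function.update S r l) := by
  have hv : (Fin.ofNat (N + 1) r).val = r := Nat.mod_eq_of_lt hr
  funext k
  rcases k with _ | i
  · rw [Function.update_of_ne (by simp)]; rfl
  · by_cases h : i = Fin.ofNat (N + 1) r
    · subst h
      rw [Function.update_self]
      simp only [machineStacks, hv, Function.update_self]
    · have : i.val ≠ r := fun e => h (Fin.ext (by rw [hv, e]))
      rw [Function.update_of_ne (by simpa using h)]
      simp [machineStacks, this]

theorem machineStacks_ofNat {N r : ℕ} (hr : r < N + 1) (inp : List (Option Bool))
    (S : ℕ → List Bool) :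
    machineStacks N inp S (some (Fin.ofNat (N + 1) r)) = S r := by
  simp only [machineStacks, Fin.val_ofNat, Nat.mod_eq_of_lt hr]

/-- The statement type of the compiled machine. The internal state is the symbol read last. -/
abbrev MStmt (N : ℕ) (L : Type) := TM2.Stmt (StackSym N) L (Option (Option Bool))

namespace Prog

/-- The compiled program, with its labels embedded by `f` and with exit label `ex`. -/
def code (N : ℕ) {L : Type} : (p : Prog) → (p.Lab → L) → L → p.Lab → MStmt N L
  | skip, _, ex, _ => .goto fun _ => ex
  | push r a, _, ex, _ => .push (some (Fin.ofNat (N + 1) r)) (fun _ => a) (.goto fun _ => ex)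
  | pop r k, f, ex, l => match l with
    | none => .pop (some (Fin.ofNat (N + 1) r)) (fun _ o => Option.map some o)
        (.goto fun v => f (some ⟨v.join, (k v.join).entry⟩))
    | some ⟨o, l⟩ => code N (k o) (fun l => f (some ⟨o, l⟩)) ex l
  | seq p q, f, ex, l => match l with
    | Sum.inl l => code N p (fun l => f (Sum.inl l)) (f (Sum.inr q.entry)) l
    | Sum.inr l => code N q (fun l => f (Sum.inr l)) ex l
  | loop r k, f, ex, l => match l with
    | none => .pop (some (Fin.ofNat (N + 1) r)) (fun _ o => Option.map some o)
        (.goto fun v => match v.join with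
          | none => ex
          | some a => f (some ⟨a, (k a).entry⟩))
    | some ⟨o, l⟩ => code N (k o) (fun l => f (some ⟨o, l⟩)) (f none) l

end Prog

/-- The machine with program `M` gets from `c` to `c'` in at most `t` steps. -/
def Steps {N : ℕ} {L : Type} (M : L → MStmt N L)
    (c c' : TM2.Cfg (StackSym N) L (Option (Option Bool))) (t : ℕ) : Prop :=
  Nonempty (EvalsToInTime (TM2.step M) c (some c') t)

namespace Steps

variable {N : ℕ} {L : Type} {M : L → MStmt N L}
  {c c' c'' : TM2.Cfg (StackSym N) L (Option (Option Bool))} {t t' : ℕ}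

theorem trans (h : Steps M c c' t) (h' : Steps M c' c'' t') : Steps M c c'' (t + t') := by
  obtain ⟨h⟩ := h
  obtain ⟨h'⟩ := h'
  rw [add_comm]
  exact ⟨EvalsToInTime.trans _ _ _ _ _ _ h h'⟩

theorem mono (h : Steps M c c' t) (ht : t ≤ t') : Steps M c c' t' := by
  obtain ⟨h⟩ := h
  exact ⟨⟨h.1, h.2.trans ht⟩⟩

theorem single {l v S} (h : TM2.stepAux (M l) v S = c') : Steps M ⟨some l, v, S⟩ c' 1 :=
  ⟨⟨⟨1, by simp [flip, TM2.step, h]⟩, le_rfl⟩⟩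

end Steps

/-- Each unit of cost pays for one step of the machine. `f` and `ex` are arbitrary because the
induction descends into subprograms, whose exit is the entry of the next program or of the enclosing
loop. The state `v'` does not matter: every jump that inspects the state directly follows a pop that
overwrites it. -/
theorem Prog.Exec.steps {N : ℕ} {L : Type} {M : L → MStmt N L} {p S S' t}
    (h : Prog.Exec p S S' t) (f : p.Lab → L) (ex : L) (hp : p.bound ≤ N + 1)
    (hM : ∀ l, M (f l) = p.code N f ex l) (v) :
    ∃ v', Steps M ⟨some (f p.entry), v, machineStacks N [] S⟩
      ⟨some ex, v', machineStacks N [] S'⟩ t := by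
  induction h generalizing ex v with
  | skip S => exact ⟨v, .single (by rw [hM]; rfl)⟩
  | push r a S =>
    refine ⟨v, .single ?_⟩
    have hr : r < N + 1 := hp
    rw [hM]
    simp only [code, TM2.stepAux]
    rw [machineStacks_ofNat hr, update_machineStacks hr]
  | @pop r k S S' t _ ih =>
    have hr : r < N + 1 := (le_max_left _ _).trans hp
    obtain ⟨v', h⟩ := ih (fun l => f (some ⟨_, l⟩)) ex ((bound_pop_le r k _).trans hp)
      (fun l => hM (some ⟨_, l⟩)) ((S r).head?.map some)
    refine ⟨v', Steps.mono (Steps.trans (Steps.single ?_) h) (add_comm _ _).le⟩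
    rw [hM]
    simp only [entry, code, TM2.stepAux]
    rw [machineStacks_ofNat hr, update_machineStacks hr]
    have : ((S r).head?.map some).join = (S r).head? := by cases (S r).head? <;> rfl
    rw [this]
  | @seq p q S S' S'' t t' _ _ ih₁ ih₂ =>
    obtain ⟨v₁, h₁⟩ := ih₁ (fun l => f (Sum.inl l)) (f (Sum.inr q.entry))
      ((le_max_left _ _).trans hp) (fun l => hM (Sum.inl l)) v
    obtain ⟨v₂, h₂⟩ := ih₂ (fun l => f (Sum.inr l)) ex
      ((le_max_right _ _).trans hp) (fun l => hM (Sum.inr l)) v₁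
    exact ⟨v₂, h₁.trans h₂⟩
  | @loop_nil r k S e =>
    have hr : r < N + 1 := (le_max_left _ _).trans hp
    refine ⟨none, .single ?_⟩
    rw [hM]
    simp only [entry, code, TM2.stepAux]
    rw [machineStacks_ofNat hr, update_machineStacks hr, e]
    have : Function.update S r ([] : List Bool).tail = S := by
      rw [List.tail_nil, ← e, Function.update_eq_self]
    rw [this]
    rfl
  | @loop_cons r k S S' S'' a l t t' e _ _ ih₁ ih₂ =>
    have hr : r < N + 1 := (le_max_left _ _).trans hp
    obtain ⟨v₁, h₁⟩ := ih₁ (fun l => f (some ⟨_, l⟩)) (f none) ((bound_loop_le r k _).trans hp)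
      (fun l => hM (some ⟨_, l⟩)) (some (some a))
    obtain ⟨v₂, h₂⟩ := ih₂ f ex hp hM v₁
    refine ⟨v₂, ?_⟩
    have h₀ : Steps M ⟨some (f (loop r k).entry), v, machineStacks N [] S⟩
        ⟨some (f (some ⟨a, (k a).entry⟩)), some (some a),
          machineStacks N [] (Function.update S r l)⟩ 1 := by
      refine Steps.single ?_
      rw [hM]
      simp only [entry, code, TM2.stepAux]
      rw [machineStacks_ofNat hr, update_machineStacks hr, e]
      rfl
    exact ((h₀.trans h₁).trans h₂).mono (by omega)
  | mono _ hle ih =>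
    obtain ⟨v', h⟩ := ih f ex hp hM v
    exact ⟨v', h.mono hle⟩

end GraphLocality

/-! ### Polynomial-time computation on binary trees -/

namespace GraphLocality

open Polynomial

theorem polynomial_eval_mono (q : ℕ[X]) : Monotone fun n => q.eval n := by
  intro m n h
  induction q using Polynomial.induction_on' with
  | add p q hp hq => simpa using add_le_add hp hq
  | monomial k a => simpa using Nat.mul_le_mul_left _ (Nat.pow_le_pow_left h k)

/-- Binary trees without labels, the data on which polynomial-time functions operate. -/
inductive Tree
  | nil : Tree
  | cons (x y : Tree) : Tree

namespace Tree

/-- The prefix code of a tree. -/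
def word : Tree → List Bool
  | nil => [false]
  | cons x y => true :: (x.word ++ y.word)

/-- The length of the prefix code of a tree. -/
def size (x : Tree) : ℕ := x.word.length

@[simp] theorem size_nil : nil.size = 1 := rfl

@[simp] theorem size_cons (x y : Tree) : (cons x y).size = x.size + y.size + 1 := by
  simp [size, word]

theorem length_word (x : Tree) : x.word.length = x.size := rfl

theorem size_pos (x : Tree) : 1 ≤ x.size := by
  cases x <;> simp

end Tree

/-- The stacks that hold `x₀, x₁, x₂, x₃` at the positions from `b` on, nothing above and `S`
below. -/
def frame (S : ℕ → List Bool) (b : ℕ) (x₀ x₁ x₂ x₃ : List Bool) : ℕ → List Bool := fun j =>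
  if j = b then x₀ else if j = b + 1 then x₁ else if j = b + 2 then x₂ else
  if j = b + 3 then x₃ else if j < b then S j else []

section Frame

variable (S : ℕ → List Bool) (b : ℕ) (x₀ x₁ x₂ x₃ y : List Bool)

@[simp] theorem frame_zero : frame S b x₀ x₁ x₂ x₃ b = x₀ := by simp [frame]
@[simp] theorem frame_one : frame S b x₀ x₁ x₂ x₃ (b + 1) = x₁ := by simp [frame]
@[simp] theorem frame_two : frame S b x₀ x₁ x₂ x₃ (b + 2) = x₂ := by simp [frame]
@[simp] theorem frame_three : frame S b x₀ x₁ x₂ x₃ (b + 3) = x₃ := by simp [frame]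

@[simp] theorem update_frame_zero :
    Function.update (frame S b x₀ x₁ x₂ x₃) b y = frame S b y x₁ x₂ x₃ := by
  funext j
  by_cases h : j = b
  · subst h; simp
  · simp [h, frame]

@[simp] theorem update_frame_one :
    Function.update (frame S b x₀ x₁ x₂ x₃) (b + 1) y = frame S b x₀ y x₂ x₃ := by
  funext j
  by_cases h : j = b + 1
  · subst h; simp
  · simp [h, frame]

@[simp] theorem update_frame_two :
    Function.update (frame S b x₀ x₁ x₂ x₃) (b + 2) y = frame S b x₀ x₁ y x₃ := by
  funext j
  by_cases h : j = b + 2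
  · subst h; simp
  · simp [h, frame]

@[simp] theorem update_frame_three :
    Function.update (frame S b x₀ x₁ x₂ x₃) (b + 3) y = frame S b x₀ x₁ x₂ y := by
  funext j
  by_cases h : j = b + 3
  · subst h; simp
  · simp [h, frame]

/-- Seen from position `b + 1`, the stack `b` belongs to the preserved part below. A subroutine
started one level higher therefore leaves a value saved at `b` intact. -/
theorem frame_shift (y₀ : List Bool) : frame S b y₀ x₀ x₁ x₂ =
    frame (frame S b y₀ [] [] []) (b + 1) x₀ x₁ x₂ [] := by
  funext j
  simp only [frame]
  split_ifs <;> first | rfl | omega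

end Frame

namespace Prog

/-- Empty a stack. -/
def clear (r : ℕ) : Prog := loop r fun _ => skip

/-- Move the content of a stack to another one, in reverse order. -/
def move (r r' : ℕ) : Prog := loop r fun a => push r' a

theorem exec_clear (S : ℕ → List Bool) (r : ℕ) :
    Exec (clear r) S (Function.update S r []) (2 * (S r).length + 1) := by
  generalize h : S r = l
  induction l generalizing S with
  | nil =>
    rw [← h, Function.update_eq_self]
    exact .mono (.loop_nil h) (by simp)
  | cons a l ih =>
    have e := Exec.loop_cons (k := fun _ => skip) h (.skip _)
      (ih (Function.update S r l) (by simp))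
    rw [Function.update_idem] at e
    exact e.mono (by simp; omega)

theorem exec_move (S : ℕ → List Bool) {r r' : ℕ} (hr : r ≠ r') :
    Exec (move r r') S
      (Function.update (Function.update S r' ((S r).reverse ++ S r')) r [])
      (2 * (S r).length + 1) := by
  generalize h : S r = l
  induction l generalizing S with
  | nil =>
    have : Function.update (Function.update S r' ([].reverse ++ S r')) r [] = S := by
      rw [List.reverse_nil, List.nil_append, Function.update_eq_self, ← h,
        Function.update_eq_self]
    rw [this]
    exact .mono (.loop_nil h) (by simp)
  | cons a l ih =>
    have e := Exec.loop_cons (k := fun a => push r' a) h (.push r' a _)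
      (ih (Function.update (Function.update S r l) r' (a :: Function.update S r l r'))
        (by simp [hr]))
    have e' : ∀ X Y Z : List Bool, Function.update (Function.update (Function.update
        (Function.update S r X) r' Y) r' Z) r [] =
          Function.update (Function.update S r' Z) r [] := by
      intro X Y Z
      rw [Function.update_idem, Function.update_comm hr, Function.update_idem]
    rw [e'] at e
    refine Exec.mono (t := 1 + (2 * l.length + 1) + 1) ?_ (by simp; omega)
    simp only [Function.update_of_ne hr.symm] at e
    simpa [move] using e


/-- Copy the stack `b` to the stack `b + 1`, using `b + 2`. -/
def dup (b : ℕ) : Prog :=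
  seq (move b (b + 2)) (loop (b + 2) fun a => seq (push b a) (push (b + 1) a))

theorem exec_dup_loop (S : ℕ → List Bool) (b : ℕ) (l x y : List Bool) :
    Exec (loop (b + 2) fun a => seq (push b a) (push (b + 1) a)) (frame S b x y l [])
      (frame S b (l.reverse ++ x) (l.reverse ++ y) [] []) (3 * l.length + 1) := by
  induction l generalizing x y with
  | nil => exact (Exec.loop_nil (by simp)).mono (by simp)
  | cons a l ih =>
    have e := Exec.loop_cons (k := fun a => seq (push b a) (push (b + 1) a))
      (S := frame S b x y (a :: l) []) (frame_two ..) ((Exec.push _ _ _).seq (.push _ _ _))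
      (by simpa using ih (a :: x) (a :: y))
    refine Exec.mono (t := 1 + 1 + (3 * l.length + 1) + 1) ?_ (by simp; omega)
    simpa using e

theorem exec_dup (S : ℕ → List Bool) (b : ℕ) (x : List Bool) :
    Exec (dup b) (frame S b x [] [] []) (frame S b x x [] []) (5 * x.length + 2) := by
  have h := exec_move (frame S b x [] [] []) (show b ≠ b + 2 by omega)
  simp only [frame_zero, frame_two, update_frame_two, update_frame_zero, List.append_nil] at h
  have h' := exec_dup_loop S b x.reverse [] []
  simp only [List.reverse_reverse, List.append_nil, List.length_reverse] at h'
  exact (h.seq h').mono (by omega)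

/-- Exchange the stacks `b` and `b + 1`, using `b + 2` and `b + 3`. -/
def swap (b : ℕ) : Prog :=
  seq (move b (b + 2)) <| seq (move (b + 1) (b + 3)) <|
  seq (move (b + 3) b) (move (b + 2) (b + 1))

theorem exec_swap (S : ℕ → List Bool) (b : ℕ) (x y : List Bool) :
    Exec (swap b) (frame S b x y [] []) (frame S b y x [] [])
      (4 * x.length + 4 * y.length + 4) := by
  have h₁ := exec_move (frame S b x y [] []) (show b ≠ b + 2 by omega)
  have h₂ := exec_move (frame S b [] y x.reverse []) (show b + 1 ≠ b + 3 by omega)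
  have h₃ := exec_move (frame S b [] [] x.reverse y.reverse) (show b + 3 ≠ b by omega)
  have h₄ := exec_move (frame S b y [] x.reverse []) (show b + 2 ≠ b + 1 by omega)
  simp at h₁ h₂ h₃ h₄
  exact (h₁.seq (h₂.seq (h₃.seq h₄))).mono (by omega)

/-- Put the code of the tree with the two given subtrees on the stack `b`. -/
def join (b : ℕ) : Prog :=
  seq (move b (b + 2)) <| seq (move (b + 1) (b + 3)) <|
  seq (move (b + 3) b) <| seq (move (b + 2) b) (push b true)

theorem exec_join (S : ℕ → List Bool) (b : ℕ) (x y : Tree) :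
    Exec (join b) (frame S b x.word y.word [] []) (frame S b (Tree.cons x y).word [] [] [])
      (4 * x.size + 4 * y.size + 5) := by
  have h₁ := exec_move (frame S b x.word y.word [] []) (show b ≠ b + 2 by omega)
  have h₂ := exec_move (frame S b [] y.word x.word.reverse []) (show b + 1 ≠ b + 3 by omega)
  have h₃ := exec_move (frame S b [] [] x.word.reverse y.word.reverse) (show b + 3 ≠ b by omega)
  have h₄ := exec_move (frame S b y.word [] x.word.reverse []) (show b + 2 ≠ b by omega)
  have h₅ := Exec.push b true (frame S b (x.word ++ y.word) [] [] [])
  simp at h₁ h₂ h₃ h₄ h₅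
  exact (h₁.seq (h₂.seq (h₃.seq (h₄.seq h₅)))).mono (by simp only [Tree.length_word]; omega)

/-- One step of reading a tree: the stack `b + 1` counts the trees that are still to be read. -/
def readStep (b : ℕ) : Prog :=
  pop b fun o => match o with
    | none => skip
    | some false => push (b + 2) false
    | some true => seq (push (b + 2) true) (seq (push (b + 1) true) (push (b + 1) true))

/-- A leaf settles one pending tree; an inner node settles one and creates two. The rest of the run
is the hypothesis `h`, so that in the induction the run on the right subtree can serve as the
continuation of the run on the left one. -/
theorem exec_readLoop (S S' : ℕ → List Bool) (b : ℕ) (x : Tree) (k l r : List Bool) (t : ℕ)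
    (h : Exec (loop (b + 1) fun _ => readStep b) (frame S b l k (x.word.reverse ++ r) []) S' t) :
    Exec (loop (b + 1) fun _ => readStep b) (frame S b (x.word ++ l) (true :: k) r []) S'
      (5 * x.size + t) := by
  induction x generalizing k l r t with
  | nil =>
    refine (Exec.loop_cons (frame_one ..) (.pop ?_) h).mono (t := 1 + 1 + t + 1) (by simp)
    simpa [Tree.word] using Exec.push (b + 2) false (frame S b l k r [])
  | cons x y ihx ihy =>
    have hy := ihy k l (x.word.reverse ++ (true :: r)) t (by simpa [Tree.word] using h)
    have hx := ihx (true :: k) (y.word ++ l) (true :: r) _ hy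
    refine (Exec.loop_cons (frame_one ..) (.pop ?_) hx).mono
      (t := (1 + (1 + 1)) + 1 + (5 * x.size + (5 * y.size + t)) + 1) (by simp; omega)
    have h₁ := Exec.push (b + 2) true (frame S b (x.word ++ (y.word ++ l)) k r [])
    have h₂ := Exec.push (b + 1) true (frame S b (x.word ++ (y.word ++ l)) k (true :: r) [])
    have h₃ := Exec.push (b + 1) true
      (frame S b (x.word ++ (y.word ++ l)) (true :: k) (true :: r) [])
    simp at h₁ h₂ h₃
    simpa [Tree.word] using h₁.seq (h₂.seq h₃)

/-- Split the code of a tree on the stack `b`: the left subtree is moved to the stack `b + 2`, in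
reverse order, the right subtree stays. -/
def split (b : ℕ) : Prog :=
  pop b fun _ => seq (push (b + 1) true) (loop (b + 1) fun _ => readStep b)

theorem exec_split (S : ℕ → List Bool) (b : ℕ) (x y : Tree) :
    Exec (split b) (frame S b (Tree.cons x y).word [] [] [])
      (frame S b y.word [] x.word.reverse []) (5 * x.size + 3) := by
  have h₁ := Exec.push (b + 1) true (frame S b (x.word ++ y.word) [] [] [])
  have h₂ := exec_readLoop S (frame S b y.word [] x.word.reverse []) b x [] y.word [] 1
    (by simpa using Exec.loop_nil (by simp))
  simp at h₁
  refine (Exec.pop (k := fun _ => seq (push (b + 1) true) (loop (b + 1) fun _ => readStep b))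
    (by simpa [Tree.word] using h₁.seq h₂)).mono (by omega)

/-- Push a word on a stack. -/
def pushWord (r : ℕ) : List Bool → Prog
  | [] => skip
  | a :: l => seq (pushWord r l) (push r a)

theorem exec_pushWord (S : ℕ → List Bool) (b : ℕ) (l x₀ x₁ x₂ x₃ : List Bool) :
    Exec (pushWord b l) (frame S b x₀ x₁ x₂ x₃) (frame S b (l ++ x₀) x₁ x₂ x₃)
      (l.length + 1) := by
  induction l with
  | nil => exact .skip _
  | cons a l ih =>
    have h := Exec.push b a (frame S b (l ++ x₀) x₁ x₂ x₃)
    simp at h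
    exact (ih.seq h).mono (by simp)

theorem bound_pushWord (r : ℕ) (l : List Bool) : (pushWord r l).bound ≤ r + 1 := by
  induction l with
  | nil => simp [pushWord, bound]
  | cons a l ih => simp [pushWord, bound, ih]

theorem bound_dup (b : ℕ) : (dup b).bound ≤ b + 4 := by simp [dup, move, bound]
theorem bound_swap (b : ℕ) : (swap b).bound ≤ b + 4 := by simp [swap, move, bound]
theorem bound_join (b : ℕ) : (join b).bound ≤ b + 4 := by simp [join, move, bound]
theorem bound_split (b : ℕ) : (split b).bound ≤ b + 4 := by simp [split, readStep, bound]

end Prog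

open Prog

/-- The tree `e₂ i` can be computed from the tree `e₁ i` in polynomial time, uniformly in `i`. -/
def Comp {ι : Type} (e₁ e₂ : ι → Tree) : Prop :=
  ∃ (p : ℕ → Prog) (q : ℕ[X]) (m : ℕ), (∀ b, (p b).bound ≤ b + m) ∧
    ∀ i S b, Exec (p b) (frame S b (e₁ i).word [] [] []) (frame S b (e₂ i).word [] [] [])
      (q.eval (e₁ i).size)

namespace Comp

variable {ι κ : Type} {e e₁ e₂ e₃ : ι → Tree}

theorem reindex (h : Comp e₁ e₂) (f : κ → ι) : Comp (fun k => e₁ (f k)) fun k => e₂ (f k) := by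
  obtain ⟨p, q, m, hb, hp⟩ := h
  exact ⟨p, q, m, hb, fun k => hp (f k)⟩

theorem refl (e : ι → Tree) : Comp e e :=
  ⟨fun _ => skip, 1, 0, fun b => by simp [bound], fun i S b => by simpa using Exec.skip _⟩

theorem size_le (h : Comp e₁ e₂) : ∃ q : ℕ[X], ∀ i, (e₂ i).size ≤ q.eval (e₁ i).size := by
  obtain ⟨p, q, m, hb, hp⟩ := h
  refine ⟨X + q, fun i => ?_⟩
  have := (hp i (fun _ => []) 0).length_le 0
  have h0 := frame_zero (fun _ => []) 0
  simp only [h0] at this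
  simpa [Tree.size] using this

theorem trans (h : Comp e₁ e₂) (h' : Comp e₂ e₃) : Comp e₁ e₃ := by
  obtain ⟨s, hs⟩ := h.size_le
  obtain ⟨p, q, m, hb, hp⟩ := h
  obtain ⟨p', q', m', hb', hp'⟩ := h'
  refine ⟨fun b => seq (p b) (p' b), q + q'.comp s, m + m', fun b => ?_, fun i S b => ?_⟩
  · have := hb b
    have := hb' b
    simp only [bound, sup_le_iff]
    omega
  · refine ((hp i S b).seq (hp' i S b)).mono ?_
    have := polynomial_eval_mono q' (hs i)
    simpa using this

/-- The first result is computed on a copy above the saved input. After a swap the second one is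
computed from the original, above the first result, and the two are joined. -/
theorem pair (h : Comp e e₁) (h' : Comp e e₂) : Comp e fun i => .cons (e₁ i) (e₂ i) := by
  obtain ⟨s, hs⟩ := h.size_le
  obtain ⟨s', hs'⟩ := h'.size_le
  obtain ⟨p, q, m, hb, hp⟩ := h
  obtain ⟨p', q', m', hb', hp'⟩ := h'
  refine ⟨fun b => seq (dup b) <| seq (p (b + 1)) <| seq (swap b) <| seq (p' (b + 1)) (join b),
    9 * X + q + q' + 8 * s + 4 * s' + 11, m + m' + 4, fun b => ?_, fun i S b => ?_⟩
  · have := hb (b + 1)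
    have := hb' (b + 1)
    have := bound_dup b
    have := bound_swap b
    have := bound_join b
    simp only [bound, sup_le_iff]
    omega
  · have h₁ := exec_dup S b (e i).word
    have h₂ := hp i (frame S b (e i).word [] [] []) (b + 1)
    have h₃ := exec_swap S b (e i).word (e₁ i).word
    have h₄ := hp' i (frame S b (e₁ i).word [] [] []) (b + 1)
    have h₅ := exec_join S b (e₁ i) (e₂ i)
    simp only [← frame_shift] at h₂ h₄
    refine (h₁.seq (h₂.seq (h₃.seq (h₄.seq h₅)))).mono ?_
    have := hs i
    have := hs' i
    simp [Tree.length_word]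
    omega

theorem fst (x y : ι → Tree) : Comp (fun i => .cons (x i) (y i)) x := by
  refine ⟨fun b => seq (split b) (seq (clear b) (move (b + 2) b)), 9 * X + 5, 4, fun b => ?_,
    fun i S b => ?_⟩
  · have := bound_split b
    simp [bound, clear, move]
    omega
  · have h₁ := exec_split S b (x i) (y i)
    have h₂ := exec_clear (frame S b (y i).word [] (x i).word.reverse []) b
    have h₃ := exec_move (frame S b [] [] (x i).word.reverse []) (show b + 2 ≠ b by omega)
    simp at h₂ h₃
    refine (h₁.seq (h₂.seq h₃)).mono ?_
    simp [Tree.length_word]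
    omega

theorem snd (x y : ι → Tree) : Comp (fun i => .cons (x i) (y i)) y := by
  refine ⟨fun b => seq (split b) (clear (b + 2)), 9 * X + 5, 4, fun b => ?_,
    fun i S b => ?_⟩
  · have := bound_split b
    simp [bound, clear]
    omega
  · have h₁ := exec_split S b (x i) (y i)
    have h₂ := exec_clear (frame S b (y i).word [] (x i).word.reverse []) (b + 2)
    simp at h₂
    refine (h₁.seq h₂).mono ?_
    simp [Tree.length_word]
    omega

theorem const (e : ι → Tree) (x : Tree) : Comp e fun _ => x := by
  refine ⟨fun b => seq (clear b) (pushWord b x.word), 2 * X + C (x.size + 2), 1, fun b => ?_,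
    fun i S b => ?_⟩
  · have := bound_pushWord b x.word
    simp [bound, clear, this]
  · have h₁ := exec_clear (frame S b (e i).word [] [] []) b
    have h₂ := exec_pushWord S b x.word [] [] [] []
    simp at h₁ h₂
    refine (h₁.seq h₂).mono ?_
    simp [Tree.length_word]
    omega

/-- The first symbol of a prefix code tells a leaf from an inner node. The branches are indexed by
subtypes, so each has to be correct only in its own case. -/
theorem ite_nil {x : ι → Tree} (hx : Comp e x)
    (h₀ : Comp (fun i : {i // x i = .nil} => e i) fun i => e₁ i)
    (h₁ : Comp (fun i : {i // x i ≠ .nil} => e i) fun i => e₁ i) : Comp e e₁ := by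
  obtain ⟨s, hs⟩ := hx.size_le
  obtain ⟨p, q, m, hb, hp⟩ := hx
  obtain ⟨p₀, q₀, m₀, hb₀, hp₀⟩ := h₀
  obtain ⟨p₁, q₁, m₁, hb₁, hp₁⟩ := h₁
  refine ⟨fun b => seq (dup b) <| seq (p (b + 1)) <| pop (b + 1) fun o =>
    match o with
    | some true => seq (clear (b + 1)) (p₁ b)
    | _ => p₀ b, 5 * X + q + q₀ + q₁ + 2 * s + 6, m + m₀ + m₁ + 4, fun b => ?_,
    fun i S b => ?_⟩
  · have := hb (b + 1)
    have := hb₀ b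
    have := hb₁ b
    have := bound_dup b
    simp only [bound, sup_le_iff, clear]
    omega
  · have h₁ := exec_dup S b (e i).word
    have h₂ := hp i (frame S b (e i).word [] [] []) (b + 1)
    simp only [← frame_shift] at h₂
    have hsi := hs i
    by_cases hi : x i = .nil
    · have h₃ := hp₀ ⟨i, hi⟩ S b
      rw [hi] at h₂
      refine (h₁.seq (h₂.seq (.pop (by simpa [Tree.word] using h₃)))).mono ?_
      simp [Tree.length_word]
      omega
    · have h₄ := hp₁ ⟨i, hi⟩ S b
      obtain ⟨y, z, hyz⟩ : ∃ y z, x i = .cons y z := by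
        cases hxi : x i with
        | nil => exact absurd hxi hi
        | cons y z => exact ⟨y, z, rfl⟩
      have h₃ := exec_clear (frame S b (e i).word (y.word ++ z.word) [] []) (b + 1)
      simp only [frame_one, update_frame_one] at h₃
      rw [hyz] at h₂ hsi
      refine (h₁.seq (h₂.seq (.pop (by simpa [Tree.word] using h₃.seq h₄)))).mono ?_
      simp [Tree.length_word] at hsi ⊢
      omega

/-- The code of `l i` serves as the loop counter, one symbol per round. The bound `hs` on all
intermediate values is essential: polynomial-time rounds alone could let the value grow
exponentially. -/
theorem iterate {l : ι → Tree} {x : ι → ℕ → Tree}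
    (h : Comp (fun k : ι × ℕ => x k.1 k.2) fun k => x k.1 (k.2 + 1)) (s : ℕ[X])
    (hs : ∀ i n, n ≤ (l i).size → (x i n).size ≤ s.eval ((l i).size + (x i 0).size)) :
    Comp (fun i => .cons (l i) (x i 0)) fun i => x i (l i).size := by
  obtain ⟨p, q, m, hb, hp⟩ := h
  have key : ∀ i S b (w : List Bool) n, w.length + n = (l i).size →
      Exec (loop b fun _ => p (b + 1)) (frame S b w (x i n).word [] [])
        (frame S b [] (x i (l i).size).word [] [])
        (w.length * (q.eval (s.eval ((l i).size + (x i 0).size)) + 1) + 1) := by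
    intro i S b w
    induction w with
    | nil =>
      intro n hn
      rw [← hn]
      simpa using Exec.loop_nil (by simp)
    | cons a w ih =>
      intro n hn
      have h₁ := hp (i, n) (frame S b w [] [] []) (b + 1)
      have h₂ := ih (n + 1) (by simp at hn; omega)
      simp only [← frame_shift] at h₁
      refine (Exec.loop_cons (k := fun _ => p (b + 1)) (frame_zero ..)
        (by simpa using h₁) h₂).mono ?_
      have := polynomial_eval_mono q (hs i n (by simp at hn; omega))
      simp only at this
      simp only [List.length_cons, Nat.add_mul, one_mul]
      omega
  -- `split` leaves the state on `b` and the reversed counter on `b + 2`. The counter must go to `b`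
  -- and the state to `b + 1`. A single move restores the reversed counter, while the state is moved
  -- twice to keep its order, both before and after the loop.
  refine ⟨fun b => seq (split b) <| seq (move b (b + 3)) <| seq (move (b + 3) (b + 1)) <|
    seq (move (b + 2) b) <| seq (loop b fun _ => p (b + 1)) <| seq (move (b + 1) (b + 2))
    (move (b + 2) b), 13 * X + X * (q.comp s + 1) + 4 * s + 9, m + 4, fun b => ?_,
    fun i S b => ?_⟩
  · have := bound_split b
    have := hb (b + 1)
    simp [bound, move]
    omega
  · have h₁ := exec_split S b (l i) (x i 0)
    have h₂ := exec_move (frame S b (x i 0).word [] (l i).word.reverse [])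
      (show b ≠ b + 3 by omega)
    have h₃ := exec_move (frame S b [] [] (l i).word.reverse (x i 0).word.reverse)
      (show b + 3 ≠ b + 1 by omega)
    have h₄ := exec_move (frame S b [] (x i 0).word (l i).word.reverse [])
      (show b + 2 ≠ b by omega)
    have h₅ := key i S b (l i).word 0 rfl
    have h₆ := exec_move (frame S b [] (x i (l i).size).word [] [])
      (show b + 1 ≠ b + 2 by omega)
    have h₇ := exec_move (frame S b [] [] (x i (l i).size).word.reverse [])
      (show b + 2 ≠ b by omega)
    simp at h₂ h₃ h₄ h₆ h₇
    refine (h₁.seq (h₂.seq (h₃.seq (h₄.seq (h₅.seq (h₆.seq h₇)))))).mono ?_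
    have e₁ := hs i _ le_rfl
    have e₂ := polynomial_eval_mono s (show (l i).size + (x i 0).size ≤
      (Tree.cons (l i) (x i 0)).size by simp)
    have e₃ := polynomial_eval_mono q e₂
    have e₄ := Nat.mul_le_mul (show (l i).size ≤ (Tree.cons (l i) (x i 0)).size by simp; omega)
      (Nat.add_le_add_right e₃ 1)
    simp [Tree.length_word] at e₁ e₂ e₃ e₄ ⊢
    omega

end Comp

end GraphLocality

/-! ### Polynomial-time functions between encoded types -/

namespace GraphLocality

open Polynomial

/-- Types whose elements are represented by trees. -/
class Enc (α : Type) where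
  /-- the tree that represents an element -/
  enc : α → Tree

open Enc

instance : Enc Unit := ⟨fun _ => .nil⟩

instance : Enc Bool := ⟨fun b => bif b then .cons .nil .nil else .nil⟩

instance {α : Type} [Enc α] : Enc (Option α) := ⟨fun o => o.elim .nil fun a => .cons (enc a) .nil⟩

instance {α β : Type} [Enc α] [Enc β] : Enc (α × β) := ⟨fun p => .cons (enc p.1) (enc p.2)⟩

instance {α : Type} [Enc α] : Enc (List α) := ⟨List.foldr (fun a t => .cons (enc a) t) .nil⟩

/-- Unary notation lets numbers act as loop counters. It is affordable because numbers occur only as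
vertex indices and lengths; colours stay lists of bits. -/
instance : Enc ℕ := ⟨fun n => enc (List.replicate n ())⟩

/-- The length of the representation of an element. -/
def esize {α : Type} [Enc α] (a : α) : ℕ := (enc a).size

section Size

variable {α β : Type} [Enc α] [Enc β]

theorem esize_pos (a : α) : 1 ≤ esize a := Tree.size_pos _

@[simp] theorem esize_prod (p : α × β) : esize p = esize p.1 + esize p.2 + 1 := by
  simp [esize, enc]

@[simp] theorem esize_nil : esize ([] : List α) = 1 := rfl

@[simp] theorem esize_cons (a : α) (l : List α) : esize (a :: l) = esize a + esize l + 1 := by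
  simp [esize, enc]

theorem esize_bool_le (b : Bool) : esize b ≤ 3 := by cases b <;> decide

theorem length_le_esize (l : List α) : l.length ≤ esize l := by
  induction l with
  | nil => simp
  | cons a l ih => simp; omega

theorem esize_le_of_mem {l : List α} {a : α} (h : a ∈ l) : esize a ≤ esize l := by
  induction l with
  | nil => simp at h
  | cons b l ih =>
    rcases List.mem_cons.1 h with rfl | h
    · simp; omega
    · have := ih h
      simp; omega

theorem esize_list_le {l : List α} {B : ℕ} (h : ∀ a ∈ l, esize a ≤ B) :
    esize l ≤ l.length * (B + 1) + 1 := by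
  induction l with
  | nil => simp
  | cons b l ih =>
    have := h b (by simp)
    have := ih fun a ha => h a (by simp [ha])
    simp only [esize_cons, List.length_cons, Nat.add_mul, one_mul] at *
    omega

theorem esize_append (l l' : List α) : esize (l ++ l') + 1 = esize l + esize l' := by
  induction l with
  | nil => simp; omega
  | cons b l ih => simp; omega

theorem esize_reverse (l : List α) : esize l.reverse = esize l := by
  induction l with
  | nil => rfl
  | cons b l ih =>
    have := esize_append l.reverse [b]
    simp at this ⊢; omega

theorem esize_drop_le (l : List α) (n : ℕ) : esize (l.drop n) ≤ esize l := by
  have := esize_append (l.take n) (l.drop n)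
  have := esize_pos (l.take n)
  simp at *; omega

theorem esize_take_le (l : List α) (n : ℕ) : esize (l.take n) ≤ esize l := by
  have := esize_append (l.take n) (l.drop n)
  have := esize_pos (l.drop n)
  simp at *; omega

theorem esize_nat (n : ℕ) : esize n = 2 * n + 1 := by
  change esize (List.replicate n ()) = _
  induction n with
  | zero => rfl
  | succ n ih =>
    have : esize () = 1 := rfl
    simp [List.replicate_succ, ih, this]; omega

end Size

/-- Functions that can be computed in polynomial time. -/
def PT {ι α : Type} [Enc ι] [Enc α] (f : ι → α) : Prop := Comp (enc : ι → Tree) fun i => enc (f i)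

namespace PT

variable {ι α β γ σ : Type} [Enc ι] [Enc α] [Enc β] [Enc γ] [Enc σ]

theorem comp {g : α → β} {f : ι → α} (hg : PT g) (hf : PT f) : PT fun i => g (f i) :=
  Comp.trans hf (Comp.reindex hg f)

theorem id : PT fun i : ι => i := Comp.refl _

theorem const (a : α) : PT fun _ : ι => a := Comp.const _ _

theorem pair {f : ι → α} {g : ι → β} (hf : PT f) (hg : PT g) : PT fun i => (f i, g i) :=
  Comp.pair hf hg

theorem fst {f : ι → α × β} (hf : PT f) : PT fun i => (f i).1 :=
  Comp.trans hf (Comp.fst (fun i => enc (f i).1) fun i => enc (f i).2)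

theorem snd {f : ι → α × β} (hf : PT f) : PT fun i => (f i).2 :=
  Comp.trans hf (Comp.snd (fun i => enc (f i).1) fun i => enc (f i).2)

theorem cons {f : ι → α} {l : ι → List α} (hf : PT f) (hl : PT l) : PT fun i => f i :: l i :=
  Comp.pair hf hl

theorem esize_le {f : ι → α} (hf : PT f) : ∃ q : ℕ[X], ∀ i, esize (f i) ≤ q.eval (esize i) :=
  Comp.size_le hf

theorem cond {c : ι → Bool} {f g : ι → α} (hc : PT c) (hf : PT f) (hg : PT g) :
    PT fun i => bif c i then f i else g i := by
  refine Comp.ite_nil hc ?_ ?_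
  · convert! Comp.reindex hg (fun i : {i // enc (c i) = .nil} => i.1) using 2 with i
    have : c i = false := by
      have := i.2
      revert this
      cases c i <;> simp [enc]
    simp [this]
  · convert! Comp.reindex hf (fun i : {i // enc (c i) ≠ .nil} => i.1) using 2 with i
    have : c i = true := by
      have := i.2
      revert this
      cases c i <;> simp [enc]
    simp [this]

theorem and {c d : ι → Bool} (hc : PT c) (hd : PT d) : PT fun i => c i && d i := by
  convert! cond hc hd (const false) using 2 with i
  cases c i <;> simp

theorem or {c d : ι → Bool} (hc : PT c) (hd : PT d) : PT fun i => c i || d i := by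
  convert! cond hc (const true) hd using 2 with i

theorem not {c : ι → Bool} (hc : PT c) : PT fun i => !c i := by
  convert! cond hc (const false) (const true) using 2 with i

theorem beqBool {c d : ι → Bool} (hc : PT c) (hd : PT d) : PT fun i => c i == d i := by
  convert! cond hc hd hd.not using 2 with i
  cases c i <;> cases d i <;> rfl

/-- A nonempty list and the pair of its head and tail are the same tree. Pairing the input with the
list thus already gives the code of the argument of `g`. -/
theorem listCase {l : ι → List α} {f : ι → β} {g : ι × α × List α → β} (hl : PT l) (hf : PT f)
    (hg : PT g) : PT fun i => List.casesOn (motive := fun _ => β) (l i) (f i)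
      fun a t => g (i, a, t) := by
  have h₀ : ∀ i, enc (l i) = .nil → l i = [] := fun i hi => by
    cases h : l i with
    | nil => rfl
    | cons a t => rw [h] at hi; exact absurd hi (by simp [enc])
  have h₁ : ∀ i : {i // enc (l i) ≠ .nil}, l i ≠ [] := fun i h => i.2 (by rw [h]; rfl)
  refine Comp.ite_nil hl ?_ ?_
  · convert! Comp.reindex hf (fun i : {i // enc (l i) = .nil} => i.1) using 2 with i
    simp [h₀ i i.2]
  · let k : {i // enc (l i) ≠ .nil} → ι × α × List α :=
      fun i => (i.1, (l i).head (h₁ i), (l i).tail)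
    have hk : ∀ i, l i.1 = (k i).2.1 :: (k i).2.2 := fun i => (List.cons_head_tail (h₁ i)).symm
    refine Comp.trans (Comp.reindex (PT.pair PT.id hl) Subtype.val) ?_
    convert! Comp.reindex hg k using 2 with i i
    · simp only [hk i]; rfl
    · simp only [hk i]; rfl

theorem headD {l : ι → List α} {d : ι → α} (hl : PT l) (hd : PT d) :
    PT fun i => (l i).headD (d i) := by
  convert! listCase hl hd (PT.fst (PT.snd PT.id)) using 2 with i
  cases l i <;> rfl

theorem tail {l : ι → List α} (hl : PT l) : PT fun i => (l i).tail := by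
  convert! listCase hl (const []) (PT.snd (PT.snd PT.id)) using 2 with i
  cases l i <;> rfl

theorem isEmpty {l : ι → List α} (hl : PT l) : PT fun i => (l i).isEmpty := by
  convert! listCase hl (const true) (const false) using 2 with i
  cases l i <;> rfl

theorem toList {o : ι → Option α} (ho : PT o) : PT fun i => (o i).toList := by
  have h : ∀ o : Option α, enc o.toList = enc o := fun o => by cases o <;> rfl
  unfold PT
  simp only [h]
  exact ho

/-- The iterated state is the input, the accumulator and the unread part of the list. The number of
rounds is the code size of the list, which is at least its length; surplus rounds do nothing, since
`step` is the identity once the list is used up. -/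
theorem foldl {f : ι × σ × α → σ} {s : ι → σ} {l : ι → List α} (hf : PT f) (hs : PT s) (hl : PT l)
    (hq : ∃ q : ℕ[X], ∀ i n,
      esize (((l i).take n).foldl (fun s a => f (i, s, a)) (s i)) ≤ q.eval (esize i)) :
    PT fun i => (l i).foldl (fun s a => f (i, s, a)) (s i) := by
  let step : ι × σ × List α → ι × σ × List α := fun p =>
    List.casesOn (motive := fun _ => ι × σ × List α) p.2.2 p
      fun a t => (p.1, f (p.1, p.2.1, a), t)
  have hstep : PT step := by
    refine listCase (g := fun p => (p.1.1, f (p.1.1, p.1.2.1, p.2.1), p.2.2))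
      (PT.snd (PT.snd PT.id)) PT.id ?_
    have h1 : PT fun p : (ι × σ × List α) × α × List α => p.1.1 := PT.id.fst.fst
    exact h1.pair (PT.pair (hf.comp (h1.pair (PT.id.fst.snd.fst.pair PT.id.snd.fst))) PT.id.snd.snd)
  have hit : ∀ i n, step^[n] (i, s i, l i) =
      (i, ((l i).take n).foldl (fun s a => f (i, s, a)) (s i), (l i).drop n) := by
    intro i n
    induction n with
    | zero => simp
    | succ n ih =>
      rw [Function.iterate_succ_apply', ih]
      simp only [step]
      by_cases hn : n < (l i).length
      · rw [List.drop_eq_getElem_cons hn, List.take_succ_eq_append_getElem hn, List.foldl_append]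
        rfl
      · rw [List.drop_of_length_le (by omega), List.take_of_length_le (by omega),
          List.drop_of_length_le (by omega), List.take_of_length_le (by omega)]
  obtain ⟨q, hq⟩ := hq
  obtain ⟨ql, hql⟩ := hl.esize_le
  have h := Comp.iterate (l := fun i => enc (l i))
    (x := fun i n => enc (step^[n] (i, s i, l i)))
    (by
      convert! Comp.reindex hstep fun k : ι × ℕ => step^[k.2] (k.1, s k.1, l k.1) using 2 with k
      rw [Function.iterate_succ_apply'])
    (2 * X + q) (by
      intro i n _
      have h₁ := hq i n
      have h₂ := esize_drop_le (l i) n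
      have h₃ : esize (step^[n] (i, s i, l i)) ≤ esize i + q.eval (esize i) + esize (l i) + 2 := by
        rw [hit]; simp only [esize_prod]; omega
      have h₄ : esize i + esize (l i) + 2 ≤ esize (step^[0] (i, s i, l i)) := by
        simp
      have h₅ := polynomial_eval_mono q (show esize i ≤
        (enc (l i)).size + esize (step^[0] (i, s i, l i)) by omega)
      simp only [eval_add, eval_mul, eval_X, eval_ofNat]
      simp only [esize] at *
      omega)
  have h' := ((hl.pair (PT.id.pair (hs.pair hl))).trans h)
  have h'' : PT fun i => step^[esize (l i)] (i, s i, l i) := h'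
  convert! h''.snd.fst using 2 with i
  rw [hit, List.take_of_length_le (length_le_esize _)]

theorem foldl_bool {f : ι × Bool × α → Bool} {s : ι → Bool} {l : ι → List α} (hf : PT f)
    (hs : PT s) (hl : PT l) : PT fun i => (l i).foldl (fun s a => f (i, s, a)) (s i) :=
  foldl hf hs hl ⟨3, fun i n => by simpa using esize_bool_le _⟩

theorem any {p : ι × α → Bool} {l : ι → List α} (hp : PT p) (hl : PT l) :
    PT fun i => (l i).any fun a => p (i, a) := by
  have h : ∀ (l : List α) (p : α → Bool) b, (b || l.any p) = l.foldl (fun b a => b || p a) b := by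
    intro l p b
    induction l generalizing b with
    | nil => simp
    | cons a l ih => simp [← ih, Bool.or_assoc]
  convert! foldl_bool (f := fun x => x.2.1 || p (x.1, x.2.2))
    (or PT.id.snd.fst (hp.comp (PT.id.fst.pair PT.id.snd.snd))) (const false) hl using 2 with i
  simpa using h (l i) (fun a => p (i, a)) false

theorem all {p : ι × α → Bool} {l : ι → List α} (hp : PT p) (hl : PT l) :
    PT fun i => (l i).all fun a => p (i, a) := by
  convert! (any hp.not hl).not using 2 with i
  rw [List.all_eq_not_any_not]

theorem reverse {l : ι → List α} (hl : PT l) : PT fun i => (l i).reverse := by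
  obtain ⟨q, hq⟩ := hl.esize_le
  convert! foldl (f := fun x : ι × List α × α => x.2.2 :: x.2.1) (s := fun _ => [])
    (cons PT.id.snd.snd PT.id.snd.fst) (const []) hl ⟨q, fun i n => ?_⟩ using 2 with i
  · simp
  · have := hq i
    have := esize_take_le (l i) n
    simp [esize_reverse]
    omega

theorem map {f : ι × α → β} {l : ι → List α} (hf : PT f) (hl : PT l) :
    PT fun i => (l i).map fun a => f (i, a) := by
  obtain ⟨q, hq⟩ := hl.esize_le
  obtain ⟨r, hr⟩ := hf.esize_le
  have h : ∀ i (l : List α) s, l.foldl (fun s a => f (i, a) :: s) s =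
      (l.map fun a => f (i, a)).reverse ++ s := by
    intro i l s
    induction l generalizing s with
    | nil => simp
    | cons a l ih => simp [ih]
  convert! reverse (foldl (f := fun x : ι × List β × α => f (x.1, x.2.2) :: x.2.1)
    (s := fun _ => []) (cons (hf.comp (PT.id.fst.pair PT.id.snd.snd)) PT.id.snd.fst) (const []) hl
    -- `q` bounds both the length of the list and the size of its elements, so `r.comp (X + q + 1)`
    -- bounds every image.
    ⟨q * (r.comp (X + q + 1) + 1) + 1, fun i n => ?_⟩) using 2 with i
  · simp [h]
  · rw [h, List.append_nil, esize_reverse]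
    refine (esize_list_le (B := (r.comp (X + q + 1)).eval (esize i)) ?_).trans ?_
    · intro b hb
      obtain ⟨a, ha, rfl⟩ := List.mem_map.1 hb
      refine (hr _).trans ?_
      rw [eval_comp]
      refine polynomial_eval_mono r ?_
      have := esize_le_of_mem (List.mem_of_mem_take ha)
      have := hq i
      simp; omega
    · have := length_le_esize (l i)
      have := hq i
      simp only [eval_add, eval_mul, eval_one, List.length_map, List.length_take]
      gcongr
      omega

/-- Iteration of a function as often as a number says. -/
theorem iterate {f : ι × σ → σ} {s : ι → σ} {n : ι → ℕ} (hf : PT f) (hs : PT s) (hn : PT n)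
    (hq : ∃ q : ℕ[X], ∀ i k, k ≤ n i → esize ((fun s => f (i, s))^[k] (s i)) ≤ q.eval (esize i)) :
    PT fun i => (fun s => f (i, s))^[n i] (s i) := by
  have h : ∀ i k s, (List.replicate k ()).foldl (fun s _ => f (i, s)) s =
      (fun s => f (i, s))^[k] s := by
    intro i k s
    induction k generalizing s with
    | zero => rfl
    | succ k ih => simp [List.replicate_succ, ih]
  obtain ⟨q, hq⟩ := hq
  have hn' : PT fun i => List.replicate (n i) () := hn
  convert! foldl (f := fun x : ι × σ × Unit => f (x.1, x.2.1))
    (hf.comp (PT.id.fst.pair PT.id.snd.fst)) hs hn' ⟨q, fun i k => ?_⟩ using 2 with i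
  · exact (h _ _ _).symm
  · rw [List.take_replicate, h]
    exact hq i _ (min_le_right _ _)

theorem drop {l : ι → List α} {n : ι → ℕ} (hl : PT l) (hn : PT n) :
    PT fun i => (l i).drop (n i) := by
  obtain ⟨q, hq⟩ := hl.esize_le
  have h : ∀ (l : List α) k, List.tail^[k] l = l.drop k := by
    intro l k
    induction k generalizing l with
    | zero => rfl
    | succ k ih => simp [ih]
  convert! iterate (f := fun x : ι × List α => x.2.tail) PT.id.snd.tail hl hn
    ⟨q, fun i k _ => ?_⟩ using 2 with i
  · exact (h _ _).symm
  · exact (h (l i) k).symm ▸ (esize_drop_le _ _).trans (hq i)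

theorem getD {l : ι → List α} {n : ι → ℕ} {d : ι → α} (hl : PT l) (hn : PT n) (hd : PT d) :
    PT fun i => (l i).getD (n i) (d i) := by
  convert! headD (drop hl hn) hd using 2 with i
  simp [List.getD_eq_getElem?_getD, List.headD_eq_head?_getD]

theorem length {l : ι → List α} (hl : PT l) : PT fun i => (l i).length := by
  have : PT fun i => (l i).map fun _ => () := map (const ()) hl
  simp only [List.map_const'] at this
  exact this

/-- Shifting a range by one and prepending `0` gives the next range, and the successor of a unary
number is one `cons`. -/
theorem range {n : ι → ℕ} (hn : PT n) : PT fun i => List.range (n i) := by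
  obtain ⟨q, hq⟩ := hn.esize_le
  have hsucc : PT fun k : ℕ => k + 1 := by
    have h1 : PT fun k : ℕ => List.replicate k () := PT.id
    have h2 := cons (const ()) h1
    exact h2
  have h : ∀ k, (fun s : List ℕ => 0 :: s.map (· + 1))^[k] [] = List.range k := by
    intro k
    induction k with
    | zero => rfl
    | succ k ih => rw [Function.iterate_succ_apply', ih, List.range_succ_eq_map]
  convert! iterate (f := fun x : ι × List ℕ => 0 :: x.2.map (· + 1))
    (cons (const 0) (map (hsucc.comp PT.id.snd) PT.id.snd)) (const []) hn
    ⟨q * (q + 1) + 1, fun i k hk => ?_⟩ using 2 with i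
  · exact (h _).symm
  · rw [h]
    have hi := hq i
    have hi' := esize_nat (n i)
    refine (esize_list_le (B := q.eval (esize i)) fun a ha => ?_).trans ?_
    · have := esize_nat a
      have := List.mem_range.1 ha
      omega
    · simp only [List.length_range, eval_add, eval_mul, eval_one]
      gcongr
      omega

/-- The fold over `l` carries the unread rest of `l'`. Running out of `l'` clears the flag, so the
default of `headD` has no influence; at the end the rest must be empty. -/
theorem beqList {l l' : ι → List Bool} (hl : PT l) (hl' : PT l') : PT fun i => l i == l' i := by
  have h : ∀ (l l' : List Bool) b, (b && (l == l')) =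
      ((fun p : Bool × List Bool => p.1 && p.2.isEmpty) <|
        l.foldl (fun s a => (s.1 && !s.2.isEmpty && (s.2.headD false == a), s.2.tail))
          (b, l')) := by
    intro l l' b
    induction l generalizing l' b with
    | nil => cases l' <;> simp
    | cons a l ih =>
      rw [List.foldl_cons, ← ih]
      cases l' with
      | nil => simp
      | cons a' l' =>
        simp [Bool.and_assoc, Bool.beq_comm]
  obtain ⟨q, hq⟩ := hl'.esize_le
  have hf := foldl (ι := ι) (σ := Bool × List Bool)
    (f := fun x => (x.2.1.1 && !x.2.1.2.isEmpty && (x.2.1.2.headD false == x.2.2), x.2.1.2.tail))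
    (s := fun i => (true, l' i)) (l := l)
    (pair (and (and PT.id.snd.fst.fst (isEmpty PT.id.snd.fst.snd).not)
      (beqBool (headD PT.id.snd.fst.snd (const false)) PT.id.snd.snd)) PT.id.snd.fst.snd.tail)
    (pair (const true) hl') hl ⟨q + 4, fun i n => ?_⟩
  · convert! and hf.fst (isEmpty hf.snd) using 2 with i
    simpa using h (l i) (l' i) true
  · have h2 : ∀ (l : List Bool) (s : Bool × List Bool), (l.foldl (fun s a =>
        (s.1 && !s.2.isEmpty && (s.2.headD false == a), s.2.tail)) s).2 = s.2.drop l.length := by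
      intro l s
      induction l generalizing s with
      | nil => simp
      | cons a l ih => rw [List.foldl_cons, ih]; simp
    rw [esize_prod, h2]
    have := esize_bool_le (((l i).take n).foldl (fun s a =>
        (s.1 && !s.2.isEmpty && (s.2.headD false == a), s.2.tail)) (true, l' i)).1
    have := esize_drop_le (l' i) ((l i).take n).length
    have := hq i
    simp only [eval_add, eval_ofNat]
    omega

theorem beqNat {m n : ι → ℕ} (hm : PT m) (hn : PT n) : PT fun i => m i == n i := by
  have h : ∀ {n : ι → ℕ}, PT n → PT fun i => List.replicate (n i) true := by
    intro n hn
    have hn' : PT fun i => List.replicate (n i) () := hn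
    simpa using map (const true) hn'
  convert! beqList (h hm) (h hn) using 2 with i
  rw [Bool.eq_iff_iff]
  simp [List.replicate_inj]

end PT

end GraphLocality

/-! ### The machine that decides a language -/

namespace GraphLocality

open Turing StateTransition Polynomial Enc

section Machine

variable {N : ℕ} {L : Type}

/-- Push a word on the stack `0` of the machine. -/
def pushAll : List Bool → MStmt N L → MStmt N L
  | [], s => s
  | a :: l, s => pushAll l (.push (some 0) (fun _ => a) s)

theorem stepAux_pushAll (l : List Bool) (s : MStmt N L) (v) (inp) (S : ℕ → List Bool) :
    TM2.stepAux (pushAll l s) v (machineStacks N inp S) =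
      TM2.stepAux s v (machineStacks N inp (Function.update S 0 (l ++ S 0))) := by
  induction l generalizing s with
  | nil => simp [pushAll]
  | cons a l ih =>
    rw [pushAll, ih, TM2.stepAux]
    have h := update_machineStacks (N := N) (r := 0) (by omega) inp
      (Function.update S 0 (l ++ S 0)) (a :: (l ++ S 0))
    have h' := machineStacks_ofNat (N := N) (r := 0) (by omega) inp
      (Function.update S 0 (l ++ S 0))
    simp only [Fin.ofNat_zero, Function.update_idem, Function.update_self] at h h'
    rw [h', h]
    rfl

/-- The label type of the machine that decides a language: it prepares the representation of the
reversed input word, runs a program and writes the answer. -/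
abbrev DeciderLab (p : Prog) := Option Bool ⊕ p.Lab

/-- The program of the machine that decides a language. -/
def decider (N : ℕ) (p : Prog) : DeciderLab p → MStmt N (DeciderLab p)
  | .inl none => pushAll [false] (.goto fun _ => .inl (some false))
  | .inl (some false) => .pop none (fun _ o => o) <|
      .branch (fun v => v == none) (.goto fun _ => .inr p.entry) <|
      .branch (fun v => v == some none)
        (pushAll (true :: (enc (none : Option Bool)).word) (.goto fun _ => .inl (some false))) <|
      .branch (fun v => v == some (some false))
        (pushAll (true :: (enc (some false)).word) (.goto fun _ => .inl (some false)))
        (pushAll (true :: (enc (some true)).word) (.goto fun _ => .inl (some false)))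
  | .inl (some true) => .pop (some 0) (fun _ o => o.map some) <| .pop (some 0) (fun v _ => v) <|
      .pop (some 0) (fun v _ => v) <| .push (some 0) (fun v => v == some (some true)) <|
      .load (fun _ => none) .halt
  | .inr l => p.code N .inr (.inl (some true)) l

/-- Putting `true` and the code of a symbol in front of the code of a list gives the code of the
longer list, so the input is encoded while it is read. This reverses the word, which is why the
decision functions act on reversed words. -/
theorem decider_read (p : Prog) (S : ℕ → List Bool) (w u : List (Option Bool)) (v) :
    ∃ v', Steps (decider N p)
      ⟨some (.inl (some false)), v, machineStacks N w (frame S 0 (enc u).word [] [] [])⟩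
      ⟨some (.inr p.entry), v',
        machineStacks N [] (frame S 0 (enc (w.reverse ++ u)).word [] [] [])⟩ (w.length + 1) := by
  have hup : ∀ (w w' : List (Option Bool)) (S : ℕ → List Bool),
      Function.update (machineStacks N w S) none w' = machineStacks N w' S := by
    intro w w' S
    funext k
    rcases k with _ | k
    · rw [Function.update_self]; rfl
    · rw [Function.update_of_ne (by simp)]; rfl
  induction w generalizing u v with
  | nil =>
    refine ⟨none, (Steps.single ?_).mono (by simp)⟩
    simp only [decider, TM2.stepAux]
    rw [hup]
    rfl
  | cons a w ih =>
    obtain ⟨v', h⟩ := ih (a :: u) (some a)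
    rw [List.reverse_cons, List.append_assoc, List.singleton_append, List.length_cons]
    refine ⟨v', ((Steps.single ?_).trans h).mono (by omega)⟩
    simp only [decider, TM2.stepAux]
    rw [hup]
    rcases a with _ | _ | _ <;>
      simp [machineStacks, stepAux_pushAll, TM2.stepAux, enc, Tree.word]

/-- The first symbol of the code of a truth value is that value. Two further pops remove the rest of
the code of `true` and have no effect for `false`. -/
theorem decider_write (p : Prog) (b : Bool) (v) :
    Steps (decider N p)
      ⟨some (.inl (some true)), v,
        machineStacks N [] (frame (fun _ => []) 0 (enc b).word [] [] [])⟩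
      ⟨none, none, machineStacks N [] (frame (fun _ => []) 0 [b] [] [] [])⟩ 1 := by
  refine Steps.single ?_
  have h := fun S l => update_machineStacks (N := N) (r := 0) (by omega) [] S l
  have h' := fun S => machineStacks_ofNat (N := N) (r := 0) (by omega) [] S
  simp only [Fin.ofNat_zero] at h h'
  simp only [decider, TM2.stepAux]
  simp only [h, h', update_frame_zero, frame_zero]
  cases b <;> rfl

end Machine

/-- A language is in `P` if a polynomial-time function decides it on the reversed words. -/
theorem inP_of_pt {f : List (Option Bool) → Bool} (hf : PT f) {L : Language (Option Bool)}
    (hL : ∀ w, w ∈ L ↔ f w.reverse = true) : InP L := by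
  classical
  obtain ⟨p, q, m, hb, hp⟩ := hf
  have := (p 0).finite_lab
  let _ := Fintype.ofFinite (p 0).Lab
  let tm : FinTM2 :=
    { K := Option (Fin (m + 1))
      k₀ := none
      k₁ := some 0
      Γ := StackSym m
      Λ := DeciderLab (p 0)
      main := .inl none
      σ := Option (Option Bool)
      initialState := none
      Γk₀Fin := inferInstance
      m := decider m (p 0) }
  -- One step sets up the empty list, `w.length + 1` steps read the input, one writes the answer.
  -- The program in between starts from a code of length at most `6 * w.length + 1`: at most 5 for
  -- each symbol and 1 for its list cell.
  have key : ∀ w : List (Option Bool), Nonempty (TM2OutputsInTime tm (w.map id)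
      (some ((Computability.encodeBool (decide (w ∈ L))).map id))
      ((X + 3 + q.comp (6 * X + 1)).eval w.length)) := by
    intro w
    have hw : decide (w ∈ L) = f w.reverse := by
      rw [Bool.eq_iff_iff]
      simpa using hL w
    have hinit : initList tm (w.map id) =
        ⟨some (.inl none), none, machineStacks m w fun _ => []⟩ := by
      simp only [initList, List.map_id]
      congr 1
      funext k
      rcases k with _ | k
      · rfl
      · rfl
    have hhalt : haltList tm ((Computability.encodeBool (decide (w ∈ L))).map id) =
        ⟨none, none, machineStacks m [] (frame (fun _ => []) 0 [f w.reverse] [] [] [])⟩ := by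
      simp only [haltList, List.map_id, hw]
      congr 1
      funext k
      rcases k with _ | ⟨k, hk⟩
      · rfl
      · rcases k with _ | k
        · rfl
        · have h : (some ⟨k + 1, hk⟩ : Option (Fin (m + 1))) ≠ some 0 := by
            simp [Fin.ext_iff]
          simp only [tm, h, dif_neg, not_false_iff, machineStacks, frame]
          simp
    rw [TM2OutputsInTime, hinit, Option.map_some, hhalt]
    have h₀ : Steps (decider m (p 0)) ⟨some (.inl none), none, machineStacks m w fun _ => []⟩
        ⟨some (.inl (some false)), none, machineStacks m w
          (frame (fun _ => []) 0 (enc ([] : List (Option Bool))).word [] [] [])⟩ 1 := by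
      refine Steps.single ?_
      rw [decider, stepAux_pushAll, TM2.stepAux]
      congr 2
      funext j
      by_cases hj : j = 0
      · subst hj; rfl
      · simp [frame, hj]
    obtain ⟨v₁, h₁⟩ := decider_read (N := m) (p 0) (fun _ => []) w [] none
    obtain ⟨v₂, h₂⟩ := (hp w.reverse (fun _ => []) 0).steps (M := decider m (p 0)) .inr
      (.inl (some true)) (by have := hb 0; omega) (fun l => rfl) v₁
    rw [List.append_nil] at h₁
    have h₃ := decider_write (N := m) (p 0) (f w.reverse) v₂
    refine (((h₀.trans h₁).trans h₂).trans h₃).mono ?_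
    have hs : esize w.reverse ≤ 6 * w.length + 1 := by
      have := esize_list_le (l := w.reverse) (B := 5) fun a _ => by
        rcases a with _ | _ | _ <;> decide
      simp at this
      omega
    have := polynomial_eval_mono q hs
    simp [esize] at this ⊢
    omega
  exact ⟨⟨⟨tm, Equiv.refl _, Equiv.refl _⟩, X + 3 + q.comp (6 * X + 1), fun w => (key w).some⟩,
    fun k => inferInstanceAs (Finite (StackSym m k))⟩

end GraphLocality

/-! ### The decision procedure and its running time -/

namespace GraphLocality

open Polynomial Enc

section Algorithm

/-- One step of reading the encoding of a coloured graph from its end. The state consists of a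
flag and of two lists of blocks, to be read alternately; the first of them contains the current
block. -/
def parseStep (s : Bool × List (List Bool) × List (List Bool)) (a : Option Bool) :
    Bool × List (List Bool) × List (List Bool) :=
  bif a.toList.isEmpty then (s.1, [] :: s.2.2, s.2.1)
  else bif s.2.1.isEmpty then (false, s.2)
  else (s.1, (a.toList.headD false :: s.2.1.headD []) :: s.2.1.tail, s.2.2)

/-- The colours of the vertices in binary, and the rows of the adjacency matrix. -/
abbrev Rep := List (List Bool) × List (List Bool)

/-- Read the reversed encoding of a coloured graph. -/
def parse (w : List (Option Bool)) : Bool × Rep :=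
  w.foldl parseStep (true, [], [])

/-- The colour of a vertex. -/
def Rep.col (x : Rep) (i : ℕ) : List Bool := x.1.getD i []

/-- The entries of the adjacency matrix. -/
def Rep.adj (x : Rep) (i j : ℕ) : Bool := (x.2.getD i []).getD j false

/-- The list of the vertices. -/
def Rep.verts (x : Rep) : List ℕ := List.range x.1.length

/-- Whether the two lists represent a graph with a valid colouring. -/
def Rep.wf (x : Rep) : Bool :=
  (x.2.length == x.1.length) && x.2.all (fun r => r.length == x.1.length) &&
  x.1.all (fun c => c.reverse.headD false) &&
  x.verts.all fun i => x.verts.all fun j =>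
    (x.adj i j == x.adj j i) && !(x.adj i j && (x.col i == x.col j))

/-- One round of the greedy algorithm: mark all vertices of each colour whose vertices all have
marked neighbours. -/
def Rep.markStep (x : Rep) (m : List Bool) : List Bool :=
  x.verts.map fun i => m.getD i false || x.verts.all fun j => !(x.col j == x.col i) ||
    x.verts.any fun k => x.adj j k && m.getD k false

/-- The marks that the greedy algorithm makes when it starts at a vertex. -/
def Rep.marks (x : Rep) (s n : ℕ) : List Bool := x.markStep^[n] (x.verts.map fun i => i == s)

/-- Whether the greedy algorithm marks all vertices when it starts at some vertex that has a
colour of its own. -/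
def Rep.greedy (x : Rep) : Bool := x.verts.any fun s =>
  x.verts.all (fun t => !(x.col t == x.col s) || t == s) &&
  x.verts.all fun i => (x.marks s x.1.length).getD i false

/-- The decision procedure, on reversed words. -/
def decideLoc (w : List (Option Bool)) : Bool :=
  (parse w).1 && ((parse w).2.wf && (parse w).2.greedy)

end Algorithm

section PolynomialTime

theorem pt_parse : PT parse := by
  have hstep : PT fun x : List (Option Bool) × (Bool × List (List Bool) × List (List Bool)) ×
      Option Bool => parseStep x.2.1 x.2.2 := by
    have ha : PT fun x : List (Option Bool) × (Bool × List (List Bool) × List (List Bool)) ×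
      Option Bool => x.2.2.toList := PT.id.snd.snd.toList
    have hs : PT fun x : List (Option Bool) × (Bool × List (List Bool) × List (List Bool)) ×
      Option Bool => x.2.1 := PT.id.snd.fst
    exact ha.isEmpty.cond (hs.fst.pair ((PT.cons (PT.const []) hs.snd.snd).pair hs.snd.fst))
      (hs.snd.fst.isEmpty.cond ((PT.const false).pair hs.snd)
        (hs.fst.pair ((PT.cons (PT.cons (ha.headD (PT.const false))
          (hs.snd.fst.headD (PT.const []))) hs.snd.fst.tail).pair hs.snd.snd)))
  -- A separator adds an empty block, of cost 2; a bit costs at most 3, plus 1 for its list cell.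
  have hb : ∀ (w : List (Option Bool)) s, esize (w.foldl parseStep s).2 ≤
      esize s.2 + 4 * w.length := by
    intro w
    induction w with
    | nil => simp
    | cons a w ih =>
      intro s
      refine (ih _).trans ?_
      have : esize (parseStep s a).2 ≤ esize s.2 + 4 := by
        obtain ⟨ok, A, B⟩ := s
        rcases a with _ | b
        · simp [parseStep]; omega
        · rcases A with _ | ⟨c, A⟩
          · simp [parseStep]
          · have := esize_bool_le b
            simp [parseStep]; omega
      simp only [List.length_cons]
      omega
  refine PT.foldl (f := fun x => parseStep x.2.1 x.2.2) hstep (PT.const _) PT.id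
    ⟨4 * X + 7, fun w n => ?_⟩
  have h₁ := hb (w.take n) (true, [], [])
  have h₂ := esize_bool_le ((w.take n).foldl parseStep (true, [], [])).1
  have h₃ := length_le_esize w
  change esize ((w.take n).foldl parseStep (true, [], [])) ≤ _
  have : min n w.length ≤ esize w := (min_le_right _ _).trans h₃
  rw [esize_prod]
  simp at h₁ ⊢
  omega

variable {ι : Type} [Enc ι] {x : ι → Rep}

theorem pt_col {i : ι → ℕ} (hx : PT x) (hi : PT i) : PT fun a => (x a).col (i a) :=
  hx.fst.getD hi (PT.const [])

theorem pt_adj {i j : ι → ℕ} (hx : PT x) (hi : PT i) (hj : PT j) :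
    PT fun a => (x a).adj (i a) (j a) :=
  (hx.snd.getD hi (PT.const [])).getD hj (PT.const false)

theorem pt_verts (hx : PT x) : PT fun a => (x a).verts := hx.fst.length.range

theorem pt_wf (hx : PT x) : PT fun a => (x a).wf := by
  have h₁ : PT fun a => ((x a).2.length == (x a).1.length) :=
    hx.snd.length.beqNat hx.fst.length
  have h₂ : PT fun a => (x a).2.all fun r => r.length == (x a).1.length :=
    PT.all (p := fun y : ι × List Bool => y.2.length == (x y.1).1.length)
      (PT.id.snd.length.beqNat (hx.comp PT.id.fst).fst.length) hx.snd
  have h₃ : PT fun a => (x a).1.all fun c => c.reverse.headD false :=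
    PT.all (p := fun y : ι × List Bool => y.2.reverse.headD false)
      (PT.id.snd.reverse.headD (PT.const false)) hx.fst
  have h₄ : PT fun y : (ι × ℕ) × ℕ => (((x y.1.1).adj y.1.2 y.2 == (x y.1.1).adj y.2 y.1.2) &&
      !((x y.1.1).adj y.1.2 y.2 && ((x y.1.1).col y.1.2 == (x y.1.1).col y.2))) := by
    have hx' : PT fun y : (ι × ℕ) × ℕ => x y.1.1 := hx.comp PT.id.fst.fst
    have hi : PT fun y : (ι × ℕ) × ℕ => y.1.2 := PT.id.fst.snd
    have hj : PT fun y : (ι × ℕ) × ℕ => y.2 := PT.id.snd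
    exact ((pt_adj hx' hi hj).beqBool (pt_adj hx' hj hi)).and
      ((pt_adj hx' hi hj).and ((pt_col hx' hi).beqList (pt_col hx' hj))).not
  exact ((h₁.and h₂).and h₃).and (PT.all (PT.all h₄ (pt_verts (hx.comp PT.id.fst))) (pt_verts hx))

theorem pt_markStep {m : ι → List Bool} (hx : PT x) (hm : PT m) :
    PT fun a => (x a).markStep (m a) := by
  have h₁ : PT fun y : ((ι × ℕ) × ℕ) × ℕ =>
      ((x y.1.1.1).adj y.1.2 y.2 && (m y.1.1.1).getD y.2 false) :=
    (pt_adj (hx.comp PT.id.fst.fst.fst) PT.id.fst.snd PT.id.snd).and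
      ((hm.comp PT.id.fst.fst.fst).getD PT.id.snd (PT.const false))
  have h₂ : PT fun y : (ι × ℕ) × ℕ => (!((x y.1.1).col y.2 == (x y.1.1).col y.1.2) ||
      (x y.1.1).verts.any fun k => (x y.1.1).adj y.2 k && (m y.1.1).getD k false) :=
    ((pt_col (hx.comp PT.id.fst.fst) PT.id.snd).beqList
      (pt_col (hx.comp PT.id.fst.fst) PT.id.fst.snd)).not.or
      (PT.any h₁ (pt_verts (hx.comp PT.id.fst.fst)))
  have h₃ : PT fun y : ι × ℕ => ((m y.1).getD y.2 false || (x y.1).verts.all fun j =>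
      !((x y.1).col j == (x y.1).col y.2) ||
        (x y.1).verts.any fun k => (x y.1).adj j k && (m y.1).getD k false) :=
    ((hm.comp PT.id.fst).getD PT.id.snd (PT.const false)).or
      (PT.all h₂ (pt_verts (hx.comp PT.id.fst)))
  exact PT.map h₃ (pt_verts hx)

/-- The vector of marks never grows, which gives the size bound that iteration requires. -/
theorem length_marks (x : Rep) (s n : ℕ) : (x.marks s n).length = x.1.length := by
  cases n with
  | zero => simp [Rep.marks, Rep.verts]
  | succ n => rw [Rep.marks, Function.iterate_succ_apply']; simp [Rep.markStep, Rep.verts]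

theorem pt_marks {s n : ι → ℕ} (hx : PT x) (hs : PT s) (hn : PT n) :
    PT fun a => (x a).marks (s a) (n a) := by
  obtain ⟨q, hq⟩ := hx.fst.esize_le
  refine PT.iterate (f := fun y : ι × List Bool => (x y.1).markStep y.2)
    (s := fun a => (x a).verts.map fun i => i == s a)
    (pt_markStep (hx.comp PT.id.fst) PT.id.snd)
    (PT.map (f := fun y : ι × ℕ => y.2 == s y.1) (PT.id.snd.beqNat (hs.comp PT.id.fst))
      (pt_verts hx)) hn ⟨4 * q + 1, fun a k _ => ?_⟩
  have h₁ := esize_list_le (l := (x a).marks (s a) k) fun b _ => esize_bool_le b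
  rw [length_marks] at h₁
  have h₂ := length_le_esize (x a).1
  have h₃ := hq a
  refine h₁.trans ?_
  simp only [eval_add, eval_mul, eval_one, eval_ofNat]
  omega

theorem pt_greedy (hx : PT x) : PT fun a => (x a).greedy := by
  have h₁ : PT fun y : (ι × ℕ) × ℕ =>
      (!((x y.1.1).col y.2 == (x y.1.1).col y.1.2) || y.2 == y.1.2) :=
    ((pt_col (hx.comp PT.id.fst.fst) PT.id.snd).beqList
      (pt_col (hx.comp PT.id.fst.fst) PT.id.fst.snd)).not.or (PT.id.snd.beqNat PT.id.fst.snd)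
  have h₂ : PT fun y : (ι × ℕ) × ℕ => ((x y.1.1).marks y.1.2 (x y.1.1).1.length).getD y.2 false :=
    (pt_marks (hx.comp PT.id.fst.fst) PT.id.fst.snd (hx.comp PT.id.fst.fst).fst.length).getD
      PT.id.snd (PT.const false)
  have h₃ : PT fun y : ι × ℕ =>
      ((x y.1).verts.all (fun t => !((x y.1).col t == (x y.1).col y.2) || t == y.2) &&
      (x y.1).verts.all fun i => ((x y.1).marks y.2 (x y.1).1.length).getD i false) :=
    (PT.all h₁ (pt_verts (hx.comp PT.id.fst))).and (PT.all h₂ (pt_verts (hx.comp PT.id.fst)))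
  exact PT.any h₃ (pt_verts hx)

theorem pt_decideLoc : PT decideLoc :=
  pt_parse.fst.and ((pt_wf pt_parse.snd).and (pt_greedy pt_parse.snd))

end PolynomialTime

end GraphLocality

/-! ### Correctness of the greedy marking -/

namespace GraphLocality

section Greedy

variable {V : Type} (G : SimpleGraph V) (c : V → ℕ)

/-- The vertices that are marked after some rounds of the greedy algorithm. -/
def markedSet (s : V) : ℕ → Set V
  | 0 => {s}
  | k + 1 => markedSet s k ∪ {i | ∀ j, c j = c i → ∃ u, G.Adj j u ∧ u ∈ markedSet s k}

variable {G c}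

theorem markedSet_mono (s : V) : Monotone (markedSet G c s) :=
  monotone_nat_of_le_succ fun _ _ h => Or.inl h

/-- A newly marked vertex belongs to its own class, so it has a neighbour that was marked before. -/
theorem reachable_of_mem_markedSet {s : V} {k : ℕ} {v : V} (h : v ∈ markedSet G c s k) :
    G.Reachable s v := by
  induction k generalizing v with
  | zero => rw [Set.mem_singleton_iff.1 h]
  | succ k ih =>
    rcases h with h | h
    · exact ih h
    · obtain ⟨u, hu, hk⟩ := h v rfl
      exact (ih hk).trans hu.symm.reachable

/-- The lists of colours that the greedy algorithm can produce. -/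
inductive Good (G : SimpleGraph V) (c : V → ℕ) (s : V) : List ℕ → Prop
  | start : (∀ t, c t = c s → t = s) → Good G c s [c s]
  | step {e : List ℕ} {v : V} : Good G c s e → c v ∉ e →
      (∀ j, c j = c v → ∃ u, G.Adj j u ∧ c u ∈ e) → Good G c s (e ++ [c v])

namespace Good

variable {s : V} {e : List ℕ}

theorem nodup (h : Good G c s e) : e.Nodup := by
  induction h with
  | start => simp
  | step _ hv _ ih =>
    rw [List.nodup_append]
    simpa using ⟨ih, fun a ha h => hv (h ▸ ha)⟩

theorem subset_range (h : Good G c s e) : ∀ x ∈ e, x ∈ Set.range c := by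
  induction h with
  | start => simp
  | step _ _ _ ih =>
    intro x hx
    rcases List.mem_append.1 hx with hx | hx
    · exact ih x hx
    · rw [List.mem_singleton.1 hx]; exact ⟨_, rfl⟩

theorem mem_start (h : Good G c s e) : c s ∈ e := by
  induction h with
  | start => simp
  | step _ _ _ ih => simp [ih]

/-- The start class is the single vertex `s`, and each vertex of an appended class is adjacent to
the part already connected to `s`. -/
theorem reachable (h : Good G c s e) (v : V) (hv : c v ∈ e) :
    (inducedByColours G c {x | x ∈ e}).Reachable ⟨s, h.mem_start⟩ ⟨v, hv⟩ := by
  induction h generalizing v with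
  | start h =>
    obtain rfl := h v (by simpa using hv)
    exact .refl _
  | @step e w h _ hw ih =>
    have hle : {v : V | c v ∈ {x | x ∈ e}} ≤ {v : V | c v ∈ {x | x ∈ e ++ [c w]}} :=
      fun v hv => List.mem_append_left _ hv
    have ih' : ∀ v (hv : c v ∈ e), (inducedByColours G c {x | x ∈ e ++ [c w]}).Reachable
        ⟨s, hle h.mem_start⟩ ⟨v, hle hv⟩ := fun v hv =>
      (ih v hv).map (SimpleGraph.induceHomOfLE G hle).toHom
    rcases List.mem_append.1 hv with hv' | hv'
    · exact ih' v hv'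
    · obtain ⟨u, hu, hue⟩ := hw v (by simpa using hv')
      refine (ih' u hue).trans (SimpleGraph.Adj.reachable ?_)
      exact hu.symm

theorem take (h : Good G c s e) {i : ℕ} (h₁ : 1 ≤ i) (h₂ : i ≤ e.length) :
    Good G c s (e.take i) := by
  induction h with
  | start h =>
    obtain rfl : i = 1 := by simp at h₂; omega
    exact .start h
  | @step e v h hv hj ih =>
    by_cases hi : i ≤ e.length
    · rw [List.take_append_of_le_length hi]
      exact ih hi
    · rw [List.take_of_length_le (by simp; omega)]
      exact .step h hv hj

theorem numComponents_eq (h : Good G c s e) :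
    numComponents (inducedByColours G c {x | x ∈ e}) = 1 := by
  have : (inducedByColours G c {x | x ∈ e}).Connected :=
    { preconnected := fun v w => (h.reachable v.1 v.2).symm.trans (h.reachable w.1 w.2)
      nonempty := ⟨⟨s, h.mem_start⟩⟩ }
  rw [numComponents, Nat.card_eq_one_iff_unique]
  exact ⟨this.preconnected.subsingleton_connectedComponent,
    ⟨SimpleGraph.connectedComponentMk _ ⟨s, h.mem_start⟩⟩⟩

theorem locSeq_eq (h : Good G c s e) : locSeq G c e = 1 := by
  have hlen : 1 ≤ e.length := List.length_pos_of_mem h.mem_start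
  apply le_antisymm
  · refine Finset.sup_le fun i hi => ?_
    rw [Finset.mem_Icc] at hi
    exact (h.take hi.1 hi.2).numComponents_eq.le
  · refine le_trans ?_ (Finset.le_sup (Finset.mem_Icc.2 ⟨le_rfl, hlen⟩))
    exact (h.take le_rfl hlen).numComponents_eq.ge

theorem length_le [Fintype V] (h : Good G c s e) : e.length ≤ Fintype.card V := by
  classical
  have : e.toFinset ⊆ Finset.univ.image c := fun x hx => by
    simpa using h.subset_range x (by simpa using hx)
  have := (Finset.card_le_card this).trans Finset.card_image_le
  rwa [List.toFinset_card_of_nodup h.nodup] at this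

end Good

/-- Excludes locality `0`, so that an upper bound of `1` already determines the value. -/
theorem one_le_locSeq [Finite V] [Nonempty V] {e : List ℕ} (h : IsMarkingSequence c e) :
    1 ≤ locSeq G c e := by
  obtain ⟨v⟩ := ‹Nonempty V›
  have hv : c v ∈ e := (h.2 _).2 ⟨v, rfl⟩
  have hlen : 1 ≤ e.length := List.length_pos_of_mem hv
  refine le_trans ?_ (Finset.le_sup (Finset.mem_Icc.2 ⟨hlen, le_rfl⟩))
  rw [List.take_length, numComponents]
  have : Nonempty (inducedByColours G c {x | x ∈ e}).ConnectedComponent :=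
    ⟨SimpleGraph.connectedComponentMk _ ⟨v, hv⟩⟩
  exact Nat.card_pos

theorem loc_eq_one_of_good [Finite V] [Nonempty V] {s : V} {e : List ℕ} (h : Good G c s e)
    (he : ∀ v, c v ∈ e) : loc G c = 1 := by
  have hm : IsMarkingSequence c e :=
    ⟨h.nodup, fun x => ⟨h.subset_range x, by rintro ⟨v, rfl⟩; exact he v⟩⟩
  apply le_antisymm
  · exact Nat.sInf_le ⟨e, hm, h.locSeq_eq⟩
  · obtain ⟨e', he', h'⟩ := Nat.sInf_mem (s := {k | ∃ e, IsMarkingSequence c e ∧ locSeq G c e = k})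
      ⟨_, e, hm, rfl⟩
    rw [loc, ← h']
    exact one_le_locSeq he'

/-- Lengths of good lists are bounded, so a longest one exists. By induction on the rounds it
contains every marked colour: a newly marked colour missing from it could be appended. -/
theorem exists_good [Fintype V] {s : V} (hs : ∀ t, c t = c s → t = s) {k : ℕ}
    (hk : ∀ v, v ∈ markedSet G c s k) : ∃ e, Good G c s e ∧ ∀ v, c v ∈ e := by
  classical
  obtain ⟨e, he, hmax⟩ : ∃ e, Good G c s e ∧ ∀ e', Good G c s e' → e'.length ≤ e.length := by
    obtain ⟨e, he, hn⟩ := Nat.findGreatest_spec (P := fun n => ∃ e, Good G c s e ∧ e.length = n)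
      (Good.start (G := G) hs).length_le ⟨_, Good.start hs, rfl⟩
    refine ⟨e, he, fun e' he' => ?_⟩
    rw [hn]
    exact Nat.le_findGreatest he'.length_le ⟨e', he', rfl⟩
  refine ⟨e, he, fun v => ?_⟩
  have key : ∀ k v, v ∈ markedSet G c s k → c v ∈ e := by
    intro k
    induction k with
    | zero =>
      intro v hv
      rw [Set.mem_singleton_iff.1 hv]
      exact he.mem_start
    | succ k ih =>
      rintro v (hv | hv)
      · exact ih v hv
      · by_contra hve
        have := hmax _ (Good.step he hve fun j hj => by
          obtain ⟨u, hu, huk⟩ := hv j hj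
          exact ⟨u, hu, ih u huk⟩)
        simp at this
  exact key k v (hk v)

/-- In a connected prefix with at least two vertices, every vertex has a neighbour. As neighbours
differ in colour, the first class is a single vertex, and a vertex of the last class of a longer
prefix has a neighbour of an earlier colour. Hence the greedy marking never falls behind an optimal
sequence. -/
theorem exists_markedSet_of_loc [Fintype V] [Nonempty V] (hc : ∀ u v, G.Adj u v → c u ≠ c v)
    (h : loc G c = 1) : ∃ s, (∀ t, c t = c s → t = s) ∧
      ∀ v, v ∈ markedSet G c s (Fintype.card V) := by
  classical
  obtain ⟨e₀, he₀⟩ := exists_isMarkingSequence c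
  obtain ⟨e, he, hloc⟩ := Nat.sInf_mem
    (s := {k | ∃ e, IsMarkingSequence c e ∧ locSeq G c e = k}) ⟨_, e₀, he₀, rfl⟩
  change _ = loc G c at hloc
  rw [h] at hloc
  have hconn : ∀ i, 1 ≤ i → i ≤ e.length →
      (inducedByColours G c {x | x ∈ e.take i}).Preconnected := by
    intro i h₁ h₂
    have : numComponents (inducedByColours G c {x | x ∈ e.take i}) ≤ 1 := by
      rw [← hloc]
      exact Finset.le_sup (f := fun i => numComponents (inducedByColours G c {x | x ∈ e.take i}))
        (Finset.mem_Icc.2 ⟨h₁, h₂⟩)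
    rw [numComponents, Finite.card_le_one_iff_subsingleton] at this
    exact fun v w => SimpleGraph.ConnectedComponent.exact (Subsingleton.elim _ _)
  -- a vertex of a connected prefix has a neighbour there unless it is the only vertex
  have hnbr : ∀ i, 1 ≤ i → i ≤ e.length → ∀ v w : V, c v ∈ e.take i → c w ∈ e.take i → v ≠ w →
      ∃ u, G.Adj v u ∧ c u ∈ e.take i := by
    intro i h₁ h₂ v w hv hw hvw
    obtain ⟨p⟩ := hconn i h₁ h₂ ⟨v, hv⟩ ⟨w, hw⟩
    cases p with
    | nil => exact absurd rfl hvw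
    | @cons _ u _ hadj _ => exact ⟨u.1, hadj, u.2⟩
  obtain ⟨x, e', rfl⟩ : ∃ x e', e = x :: e' := by
    obtain ⟨v⟩ := ‹Nonempty V›
    have := (he.2 (c v)).2 ⟨v, rfl⟩
    cases e with
    | nil => simp at this
    | cons x e' => exact ⟨x, e', rfl⟩
  obtain ⟨s, rfl⟩ := (he.2 x).1 (by simp)
  have hs : ∀ t, c t = c s → t = s := by
    intro t ht
    by_contra hts
    obtain ⟨u, hu, hue⟩ := hnbr 1 le_rfl (by simp) t s (by simp [ht]) (by simp) hts
    exact hc t u hu (by simp at hue; rw [hue, ht])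
  refine ⟨s, hs, ?_⟩
  -- Before the first round the start colour is already marked, so `k` rounds cover `k + 1` colours.
  have key : ∀ k, k ≤ e'.length → ∀ v, c v ∈ (c s :: e').take (k + 1) → v ∈ markedSet G c s k := by
    intro k
    induction k with
    | zero =>
      intro _ v hv
      exact hs v (by simpa using hv)
    | succ k ih =>
      intro hk v hv
      have hk' : k < e'.length := hk
      have htake : (c s :: e').take (k + 1 + 1) = (c s :: e').take (k + 1) ++ [e'[k]] := by
        rw [List.take_succ_eq_append_getElem (by simpa using hk')]
        simp
      by_cases hv' : c v ∈ (c s :: e').take (k + 1)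
      · exact Or.inl (ih (by omega) v hv')
      · refine Or.inr fun j hj => ?_
        have hvs : c v ≠ c s := fun h => hv' (by simp [h])
        obtain ⟨u, hu, hue⟩ := hnbr (k + 1 + 1) (by omega) (by simpa using hk') j s
          (by rw [hj]; exact hv) (by simp) (by rintro rfl; exact hvs hj.symm)
        refine ⟨u, hu, ih (by omega) u ?_⟩
        have hcv : c v = e'[k] := by
          rw [htake] at hv
          rcases List.mem_append.1 hv with h | h
          · exact absurd h hv'
          · simpa using h
        rw [htake] at hue
        rcases List.mem_append.1 hue with h | h
        · exact h
        · exact absurd (by rw [hj, hcv, List.mem_singleton.1 h]) (hc j u hu)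
  have hlen : e'.length ≤ Fintype.card V := by
    have : (c s :: e').toFinset ⊆ Finset.univ.image c := fun x hx => by
      simpa using (he.2 x).1 (by simpa using hx)
    have := (Finset.card_le_card this).trans Finset.card_image_le
    rw [List.toFinset_card_of_nodup he.1] at this
    simp at this
    omega
  intro v
  refine markedSet_mono s hlen (key _ le_rfl v ?_)
  rw [List.take_of_length_le (by simp)]
  exact (he.2 _).2 ⟨v, rfl⟩

/-- The greedy algorithm decides whether a coloured graph is connected and has locality `1`. -/
theorem connected_and_loc_iff [Fintype V] (hc : ∀ u v, G.Adj u v → c u ≠ c v) :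
    (G.Connected ∧ loc G c = 1) ↔ ∃ s, (∀ t, c t = c s → t = s) ∧
      ∀ v, v ∈ markedSet G c s (Fintype.card V) := by
  constructor
  · rintro ⟨hG, h⟩
    have := hG.nonempty
    exact exists_markedSet_of_loc hc h
  · rintro ⟨s, hs, h⟩
    have : Nonempty V := ⟨s⟩
    obtain ⟨e, he, hv⟩ := exists_good hs h
    exact ⟨{ preconnected := fun v w => (reachable_of_mem_markedSet (h v)).symm.trans
              (reachable_of_mem_markedSet (h w)) }, loc_eq_one_of_good he hv⟩

end Greedy

end GraphLocality

/-! ### Parsing, and the link between words and coloured graphs -/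

namespace GraphLocality

section Parse

/-- Blocks from two lists, alternately. -/
def interleave : List (List Bool) → List (List Bool) → List (Option Bool)
  | [], _ => []
  | a :: A, B => block a ++ interleave B A
  termination_by A B => A.length + B.length

/-- Read from the end, a separator opens a new block and exchanges the roles of the two lists, while
a bit extends the current block at its front. The flag fails exactly when a bit occurs with no open
block. -/
theorem interleave_eq_of_parse (w : List (Option Bool)) (A B : List (List Bool))
    (h : parse w.reverse = (true, A, B)) :
    w = interleave A B ∧ (A.length = B.length ∨ A.length = B.length + 1) := by
  simp only [parse, List.foldl_reverse] at h
  induction w generalizing A B with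
  | nil =>
    simp at h
    obtain ⟨rfl, rfl⟩ := h
    simp [interleave]
  | cons a w ih =>
    rw [List.foldr_cons] at h
    rcases hs : w.foldr (fun x y => parseStep y x) (true, [], []) with ⟨ok, A', B'⟩
    rw [hs] at h
    rcases a with _ | b
    · simp [parseStep] at h
      obtain ⟨rfl, rfl, rfl⟩ := h
      obtain ⟨h₁, h₂⟩ := ih _ _ hs
      refine ⟨by simp [interleave, block, ← h₁], ?_⟩
      simp; omega
    · rcases A' with _ | ⟨a, A'⟩
      · simp [parseStep] at h
      · simp [parseStep] at h
        obtain ⟨rfl, rfl, rfl⟩ := h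
        obtain ⟨h₁, h₂⟩ := ih _ _ hs
        refine ⟨?_, by simpa using h₂⟩
        rw [h₁]
        simp [interleave, block]

theorem parse_interleave (A B : List (List Bool))
    (h : A.length = B.length ∨ A.length = B.length + 1) :
    parse (interleave A B).reverse = (true, A, B) := by
  simp only [parse, List.foldl_reverse]
  induction A, B using interleave.induct with
  | case1 B =>
    obtain rfl : B = [] := List.length_eq_zero_iff.1 (by simp at h; omega)
    simp [interleave]
  | case2 a A B ih =>
    rw [interleave, List.foldr_append, ih (by simp at h; omega)]
    clear ih h
    induction a with
    | nil => simp [block, parseStep]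
    | cons b a ih =>
      simp only [block, List.map_cons, List.cons_append, List.foldr_cons] at ih ⊢
      rw [ih]
      simp [parseStep]

theorem interleave_eq_flatten (r : List (List Bool × List Bool)) :
    interleave (r.map Prod.fst) (r.map Prod.snd) =
      (r.map fun p => block p.1 ++ block p.2).flatten := by
  induction r with
  | nil => simp [interleave]
  | cons p r ih => simp [interleave, ih]

/-- The representation of a coloured graph. -/
noncomputable def ColouredGraph.rep (x : ColouredGraph) : Rep :=
  (List.ofFn fun v => (x.colour v).bits, List.ofFn x.row)

theorem ColouredGraph.encode_eq (x : ColouredGraph) :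
    x.encode = interleave x.rep.1 x.rep.2 := by
  have h := interleave_eq_flatten (List.ofFn fun v => ((x.colour v).bits, x.row v))
  simp only [List.map_ofFn, Function.comp_def] at h
  exact h.symm

end Parse

section Rep

variable (x : ColouredGraph)

theorem ColouredGraph.length_rep : x.rep.1.length = x.n := by simp [rep]

theorem ColouredGraph.col_rep (i : Fin x.n) : x.rep.col i = (x.colour i).bits := by
  simp [rep, Rep.col]

theorem ColouredGraph.adj_rep (i j : Fin x.n) : x.rep.adj i j = true ↔ x.graph.Adj i j := by
  simp [rep, Rep.adj, row]

theorem ColouredGraph.col_rep_eq_iff (i j : Fin x.n) :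
    x.rep.col i = x.rep.col j ↔ x.colour i = x.colour j := by
  rw [col_rep, col_rep]
  refine ⟨fun h => ?_, fun h => by rw [h]⟩
  rw [← foldr_bit_bits (x.colour i), h, foldr_bit_bits]

theorem Rep.mem_verts {x : Rep} {i : ℕ} : i ∈ x.verts ↔ i < x.1.length := by simp [Rep.verts]

theorem headD_reverse_cons (b : Bool) (l : List Bool) :
    (b :: l).reverse.headD false = l.reverse.headD b := by
  cases l <;> simp [List.headD_eq_head?_getD]

/-- The leading binary digit of a positive number is `1`, and `0` has no digits. Together with
`exists_bits_eq`, one test checks both that a block is a canonical binary expansion and that the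
colour is positive. -/
theorem headD_reverse_bits (k : ℕ) : k.bits.reverse.headD false = true ↔ 1 ≤ k := by
  refine ⟨fun h => ?_, fun h => ?_⟩
  · rcases k with _ | k
    · simp at h
    · omega
  · induction k using Nat.binaryRec' with
    | zero => omega
    | bit b n hn ih =>
      rw [Nat.bits_append_bit _ _ hn, headD_reverse_cons]
      rcases Nat.eq_zero_or_pos n with rfl | h
      · simpa using hn rfl
      · have := ih h
        cases hb : n.bits.reverse with
        | nil => rw [hb] at this; simp at this
        | cons a l => rw [hb] at this; simpa using this

theorem exists_bits_eq (l : List Bool) (h : l.reverse.headD false = true) :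
    ∃ k : ℕ, k.bits = l := by
  induction l with
  | nil => simp at h
  | cons b l ih =>
    rw [headD_reverse_cons] at h
    rcases l with _ | ⟨a, l⟩
    · obtain rfl : b = true := by simpa using h
      exact ⟨1, by simp⟩
    · obtain ⟨k, hk⟩ := ih (by
        cases hb : (a :: l).reverse with
        | nil => simp at hb
        | cons d m => rw [hb] at h; simpa using h)
      refine ⟨Nat.bit b k, ?_⟩
      rw [Nat.bits_append_bit, hk]
      rintro rfl
      simp at hk

theorem ColouredGraph.wf_rep :
    x.rep.wf = true ↔ ∃ ℓ, IsValidColouring x.graph ℓ x.colour := by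
  have h₁ : x.rep.wf = true ↔ (∀ v, 1 ≤ x.colour v) ∧
      ∀ u v, x.graph.Adj u v → x.colour u ≠ x.colour v := by
    have ha : (x.rep.verts.all fun i => x.rep.verts.all fun j =>
        (x.rep.adj i j == x.rep.adj j i) &&
          !(x.rep.adj i j && (x.rep.col i == x.rep.col j))) = true ↔
        ∀ u v, x.graph.Adj u v → x.colour u ≠ x.colour v := by
      simp only [List.all_eq_true, Rep.mem_verts, x.length_rep]
      constructor
      · intro h u v huv
        have := h u u.2 v v.2
        simp only [Bool.and_eq_true, Bool.not_eq_true', Bool.and_eq_false_iff, beq_iff_eq,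
          beq_eq_false_iff_ne] at this
        have h' := this.2.resolve_left (by simpa using (x.adj_rep u v).2 huv)
        exact fun e => h' ((x.col_rep_eq_iff u v).2 e)
      · intro h i hi j hj
        have e₁ := x.adj_rep ⟨i, hi⟩ ⟨j, hj⟩
        have e₂ := x.adj_rep ⟨j, hj⟩ ⟨i, hi⟩
        have e₃ := x.col_rep_eq_iff ⟨i, hi⟩ ⟨j, hj⟩
        rw [SimpleGraph.adj_comm] at e₂
        have e₄ : x.rep.adj i j = x.rep.adj j i := Bool.eq_iff_iff.2 (e₁.trans e₂.symm)
        have e₅ : ¬ (x.rep.adj i j = true ∧ x.rep.col i = x.rep.col j) := fun e =>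
          h _ _ (e₁.1 e.1) (e₃.1 e.2)
        simpa [e₄, -not_and, not_and_or] using e₅
    rw [Rep.wf, Bool.and_eq_true, ha]
    refine and_congr_left fun _ => ?_
    simp [rep, row, ← headD_reverse_bits]
  rw [h₁]
  constructor
  · rintro ⟨h, h'⟩
    -- The largest colour serves as `ℓ`, so only positivity and properness have to be tested.
    exact ⟨Finset.univ.sup x.colour, fun v => ⟨h v, Finset.le_sup (Finset.mem_univ v)⟩, h'⟩
  · rintro ⟨ℓ, h, h'⟩
    exact ⟨fun v => (h v).1, h'⟩

theorem exists_rep_eq {y : Rep} (h : y.wf = true) : ∃ x : ColouredGraph, x.rep = y := by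
  obtain ⟨cs, rs⟩ := y
  simp only [Rep.wf, Bool.and_eq_true, List.all_eq_true, beq_iff_eq, Rep.mem_verts] at h
  obtain ⟨⟨⟨h₁, h₂⟩, h₃⟩, h₄⟩ := h
  choose k hk using fun v : Fin cs.length => exists_bits_eq cs[v] (h₃ _ (List.getElem_mem _))
  let G : SimpleGraph (Fin cs.length) :=
    { Adj := fun i j => Rep.adj (cs, rs) i j = true
      symm := ⟨fun i j hij => by
        have := (h₄ i i.2 j j.2).1
        rw [← this]; exact hij⟩
      -- On the diagonal the two colours agree, so the properness test already forbids loops.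
      loopless := ⟨fun i hi => by
        have := (h₄ i i.2 i i.2).2
        simp [hi] at this⟩ }
  refine ⟨⟨cs.length, G, k⟩, Prod.ext ?_ ?_⟩
  · simp only [ColouredGraph.rep, hk]
    exact List.ofFn_getElem
  · refine List.ext_getElem (by simp [ColouredGraph.rep, h₁]) fun i hi hi' => ?_
    have hlen := h₂ rs[i] (List.getElem_mem _)
    refine List.ext_getElem (by simp [ColouredGraph.rep, ColouredGraph.row, hlen])
      fun j hj hj' => ?_
    simp [ColouredGraph.rep, ColouredGraph.row, G, Rep.adj, hi', hj']

theorem ColouredGraph.marks_rep (s i : Fin x.n) (k : ℕ) :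
    (x.rep.marks s k).getD i false = true ↔ i ∈ markedSet x.graph x.colour s k := by
  have hget : ∀ (f : ℕ → Bool) (i : Fin x.n), (x.rep.verts.map f).getD i false = f i := by
    intro f i
    simp [Rep.verts, x.length_rep]
  induction k generalizing i with
  | zero =>
    rw [Rep.marks, Function.iterate_zero, id, hget]
    simp [markedSet, Fin.ext_iff]
  | succ k ih =>
    rw [Rep.marks, Function.iterate_succ_apply', ← Rep.marks, Rep.markStep, hget]
    simp only [Bool.or_eq_true, ih, markedSet, Set.mem_union, Set.mem_ofPred_eq, List.all_eq_true,
      List.any_eq_true, Rep.mem_verts, x.length_rep, Bool.and_eq_true, Bool.not_eq_true',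
      beq_eq_false_iff_ne]
    refine or_congr Iff.rfl ⟨fun h j hj => ?_, fun h j hj => ?_⟩
    · obtain ⟨u, hu, hju, huk⟩ :=
        (h j j.2).resolve_left (not_not.2 ((x.col_rep_eq_iff j i).2 hj))
      exact ⟨⟨u, hu⟩, (x.adj_rep j ⟨u, hu⟩).1 hju, (ih ⟨u, hu⟩).1 huk⟩
    · by_cases hji : x.rep.col j = x.rep.col i
      · obtain ⟨u, hju, huk⟩ := h ⟨j, hj⟩ ((x.col_rep_eq_iff ⟨j, hj⟩ i).1 hji)
        exact Or.inr ⟨u, u.2, (x.adj_rep ⟨j, hj⟩ u).2 hju, (ih u).2 huk⟩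
      · exact Or.inl hji

theorem ColouredGraph.greedy_rep : x.rep.greedy = true ↔
    ∃ s, (∀ t, x.colour t = x.colour s → t = s) ∧
      ∀ v, v ∈ markedSet x.graph x.colour s (Fintype.card (Fin x.n)) := by
  simp only [Rep.greedy, List.any_eq_true, List.all_eq_true, Bool.and_eq_true, Rep.mem_verts,
    x.length_rep, Bool.or_eq_true, Bool.not_eq_true', beq_eq_false_iff_ne, beq_iff_eq,
    Fintype.card_fin]
  constructor
  · rintro ⟨s, hs, h₁, h₂⟩
    refine ⟨⟨s, hs⟩, fun t ht => Fin.ext ?_, fun v => ?_⟩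
    · exact (h₁ t t.2).resolve_left (not_not.2 ((x.col_rep_eq_iff t ⟨s, hs⟩).2 ht))
    · exact (x.marks_rep ⟨s, hs⟩ v x.n).1 (h₂ v v.2)
  · rintro ⟨s, h₁, h₂⟩
    refine ⟨s, s.2, fun t ht => ?_, fun v hv => ?_⟩
    · by_cases hts : x.rep.col t = x.rep.col s
      · exact Or.inr (Fin.ext_iff.1 (h₁ ⟨t, ht⟩ ((x.col_rep_eq_iff ⟨t, ht⟩ s).1 hts)))
      · exact Or.inl hts
    · exact (x.marks_rep s ⟨v, hv⟩ x.n).2 (h₂ ⟨v, hv⟩)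

/-- Acceptance must also certify that the word is an encoding: the tests in `wf` produce a coloured
graph by `exists_rep_eq`, and `interleave_eq_of_parse` recovers the word from it. -/
theorem mem_locG1_iff (w : List (Option Bool)) : w ∈ LocG1 ↔ decideLoc w.reverse = true := by
  have key : ∀ x : ColouredGraph, (x.rep.wf && x.rep.greedy) = true ↔ x.graph.Connected ∧
      (∃ ℓ : ℕ, IsValidColouring x.graph ℓ x.colour) ∧ loc x.graph x.colour = 1 := by
    intro x
    rw [Bool.and_eq_true, x.wf_rep, x.greedy_rep]
    constructor
    · rintro ⟨⟨ℓ, hℓ⟩, h⟩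
      have := (connected_and_loc_iff hℓ.2).2 h
      exact ⟨this.1, ⟨ℓ, hℓ⟩, this.2⟩
    · rintro ⟨h₁, ⟨ℓ, hℓ⟩, h₂⟩
      exact ⟨⟨ℓ, hℓ⟩, (connected_and_loc_iff hℓ.2).1 ⟨h₁, h₂⟩⟩
  constructor
  · rintro ⟨x, rfl, hx⟩
    rw [decideLoc, x.encode_eq, parse_interleave _ _ (by simp [ColouredGraph.rep])]
    simpa using (key x).2 hx
  · intro h
    rw [decideLoc, Bool.and_eq_true] at h
    obtain ⟨h₁, h₂⟩ := h
    obtain ⟨x, hx⟩ := exists_rep_eq (Bool.and_eq_true_iff.1 h₂).1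
    rw [← hx] at h₂
    refine ⟨x, ?_, (key x).1 h₂⟩
    have := interleave_eq_of_parse w _ _ (Prod.ext h₁ rfl)
    rw [x.encode_eq, hx]
    exact this.1.symm

end Rep

end GraphLocality

theorem mainTheorem3 : GraphLocality.InP GraphLocality.LocG1 := by
  exact GraphLocality.inP_of_pt GraphLocality.pt_decideLoc GraphLocality.mem_locG1_iff
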